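/- Let $N\ge 2$, and consider the problem $$(\mathcal P)\qquad \min_{x=\mathrm{col}(x_1,\dots,x_N)}\ \sum_{i=1}^N f_i(x)\quad\text{s.t.}\quad \sum_{i=1}^N A_ix_i=d,\qquad g_i(x_i)\le 0\ \ (i=1,\dots,N),$$ with $x_i\in\mathbb R^{n_i}$, $f_i:\mathbb R^{n_1+\dots+n_N}\to\mathbb R$, $g_i:\mathbb R^{n_i}\to\mathbb R^{q_i}$, $A_i\in\mathbb R^{n_0\times n_i}$, $d\in\mathbb R^{n_0}$. Put $\Omega_i=\{x_i: g_i(x_i)\le 0\}$. Assume: 1. every $f_i$ and every component of every $g_i$ is convex, $(\mathcal P)$ is feasible, and every $\Omega_i$ is compact; 2. the Lagrangian $\mathcal L(x,\lambda,\alpha)=\sum_i f_i(x)-\lambda^{\mathrm T}\bigl(\sum_iA_ix_i-d\bigr)+\sum_i\alpha_i^{\mathrm T}g_i(x_i)$ has a saddle point over $x\in\mathbb R^{n_1+\dots+n_N}$, $\lambda\in\mathbb R^{n_0}$, $\alpha\ge 0$; 3. $\mathcal G=(\{1,\dots,N\},\mathcal E)$ is a connected undirected simple graph, and $W=(w_{ij})\in\mathbb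 R_{\ge0}^{N\times N}$ is symmetric, doubly stochastic and positive semidefinite, with $w_{ii}>0$ for all $i$ and, for $i\ne j$, $w_{ij}>0$ if and only if $\{i,j\}\in\mathcal E$. For $y=\mathrm{col}(y^1,\dots,y^N)\in\mathbb R^{n_1+\dots+n_N}$ let $\tilde A_iy=A_iy^i$ and $\tilde\Omega_i=\{y: y^i\in\Omega_i\}$, and for $\tilde y=(y_1,\dots,y_N)$ with $y_i\in\mathbb R^{n_1+\dots+n_N}$ let $H(\tilde y)=\sum_i f_i(y_i)$. Let $\mathcal N_i$ be the set of neighbours of $i$ in $\mathcal G$ and $\deg(i)=|\mathcal N_i|$. Consensus-Tracking-ADMM with parameters $\rho,\sigma>0$ starts from arbitrary $y_i(0)\in\tilde\Omega_i$, with $\lambda_i(0)=0$, $\eta_i(0)=\tilde A_iy_i(0)-d/N$, $v_i(0)=\deg(i)^{-1}\sum_{j\in\mathcal N_i}\tfrac12(y_i(0)+y_j(0))$, and iterates, for $k\ge 0$ and all $i$, $$\gamma_i(k)=\sum_{s=1}^N w_{is}\eta_s(k),\qquad l_i(k)=\sum_{s=1}^N w_{is}\lambda_s(k),$$ $$y_i(k+1)=\operatorname*{argmin}_{y\in\tilde\Omega_i}\Bigl\{f_i(y)+\tfrac\rho2\deg(i)\|y-v_i(k)\|^2+l_i(k)^{\mathrm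 T}\tilde A_iy+\tfrac\sigma2\|\tilde A_iy-\tilde A_iy_i(k)+\gamma_i(k)\|^2\Bigr\},$$ $$\eta_i(k+1)=\gamma_i(k)+\tilde A_iy_i(k+1)-\tilde A_iy_i(k),\qquad \lambda_i(k+1)=l_i(k)+\sigma\,\eta_i(k+1),$$ $$v_i(k+1)=v_i(k)+\deg(i)^{-1}\sum_{s\in\mathcal N_i}\bigl(y_s(k+1)-\tfrac12y_s(k)\bigr)-\tfrac12y_i(k).$$ Consider the reformulation of $(\mathcal P)$ $$(\mathcal A_0)\qquad \min_{\tilde y\in\tilde\Omega_1\times\dots\times\tilde\Omega_N,\ \tilde\theta=(\theta_e)_{e\in\mathcal E}} H(\tilde y)\quad\text{s.t.}\quad\sum_i\tilde A_iy_i=d,\qquad y_i=\theta_e\ \text{ for all } e\in\mathcal E,\ i\in e,$$ with Lagrangian $\mathcal L^1(\tilde y,\tilde\theta,\lambda,\mu)=H(\tilde y)+\lambda^{\mathrm T}\bigl(\sum_i\tilde A_iy_i-d\bigr)+\sum_{e\in\mathcal E}\sum_{i\in e}\mu_{e,i}^{\mathrm T}(y_i-\theta_e)$. Then for every sequence generated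 by Consensus-Tracking-ADMM there exist an optimal solution $(\tilde y^*,\tilde\theta^*)$ of $(\mathcal A_0)$ and optimal multipliers $(\lambda^*,\mu^*)$, i.e. $(\tilde y^*,\tilde\theta^*,\lambda^*,\mu^*)$ is a saddle point of $\mathcal L^1$ over $\tilde y\in\tilde\Omega_1\times\dots\times\tilde\Omega_N$ and $\tilde\theta,\lambda,\mu$ free, such that, with $\tilde y(k)=(y_1(k),\dots,y_N(k))$, 1. $\lim_{k\to\infty}H(\tilde y(k+1))=H(\tilde y^*)$, the optimal value; 2. $\tilde y(k)\to\tilde y^*$ as $k\to\infty$; 3. $\lambda_i(k)\to\lambda^*$ as $k\to\infty$ for every $i=1,\dots,N$, with the same limit $\lambda^*$ for all $i$. -/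

import Mathlib

open Filter Topology
open scoped RealInnerProductSpace

noncomputable section

namespace CTADMM

/-- The space `ℝ^{n₁ + ⋯ + n_N}` of joint decisions `x = col(x₁, …, x_N)`, with the Euclidean norm;
`x i` is the block `xᵢ ∈ ℝ^{nᵢ}`. -/
abbrev Decision {N : ℕ} (n : Fin N → ℕ) : Type :=
  PiLp 2 (fun i : Fin N => EuclideanSpace ℝ (Fin (n i)))

/-- The data of the problem
`min ∑ᵢ fᵢ(x)` subject to `∑ᵢ Aᵢ xᵢ = d` and `gᵢ(xᵢ) ≤ 0` for all `i`. -/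
structure Problem (N n₀ : ℕ) (n q : Fin N → ℕ) where
  /-- local costs, depending on the decisions of all participants -/
  f : Fin N → Decision n → ℝ
  /-- local constraint functions -/
  g : (i : Fin N) → EuclideanSpace ℝ (Fin (n i)) → Fin (q i) → ℝ
  /-- blocks of the coupling constraint -/
  A : (i : Fin N) → Matrix (Fin n₀) (Fin (n i)) ℝ
  /-- right-hand side of the coupling constraint -/
  d : EuclideanSpace ℝ (Fin n₀)

namespace Problem

variable {N n₀ : ℕ} {n q : Fin N → ℕ} (P : Problem N n₀ n q)

/-- `Ωᵢ = {xᵢ | gᵢ(xᵢ) ≤ 0}`. -/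
def Omega (i : Fin N) : Set (EuclideanSpace ℝ (Fin (n i))) :=
  {z | ∀ j, P.g i z j ≤ 0}

/-- `Ãᵢ y = Aᵢ yᵢ`, where `yᵢ` is the `i`-th block of `y`. -/
def Atilde (i : Fin N) (y : Decision n) : EuclideanSpace ℝ (Fin n₀) :=
  Matrix.toEuclideanLin (P.A i) (y i)

/-- `Ω̃ᵢ`: the `i`-th block lies in `Ωᵢ`, the other blocks are free. -/
def OmegaTilde (i : Fin N) : Set (Decision n) :=
  {y | y i ∈ P.Omega i}

/-- The feasible set of the original problem. -/
def feasible : Set (Decision n) :=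
  {x | (∀ i, x i ∈ P.Omega i) ∧ ∑ i, P.Atilde i x = P.d}

/-- The Lagrangian
`∑ᵢ fᵢ(x) - λᵀ(∑ᵢ Aᵢ xᵢ - d) + ∑ᵢ αᵢᵀ gᵢ(xᵢ)` of the original problem. -/
def lagrangian (x : Decision n) (lam : EuclideanSpace ℝ (Fin n₀))
    (α : (i : Fin N) → Fin (q i) → ℝ) : ℝ :=
  ∑ i, P.f i x - ⟪lam, ∑ i, P.Atilde i x - P.d⟫ + ∑ i, ∑ j, α i j * P.g i (x i) j

/-- Convexity of the costs and the constraint functions, nonempty feasible set, compact local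
constraint sets. -/
structure ConvexCompact : Prop where
  convex_f : ∀ i, ConvexOn ℝ Set.univ (P.f i)
  convex_g : ∀ i j, ConvexOn ℝ Set.univ (fun z => P.g i z j)
  feasible_nonempty : P.feasible.Nonempty
  compact : ∀ i, IsCompact (P.Omega i)

/-- `(x, λ, α)`, with `α ≥ 0`, is a saddle point of the Lagrangian of the original problem. -/
def IsSaddle (x : Decision n) (lam : EuclideanSpace ℝ (Fin n₀))
    (α : (i : Fin N) → Fin (q i) → ℝ) : Prop :=
  (∀ i j, 0 ≤ α i j) ∧
  (∀ lam' α', (∀ i j, 0 ≤ α' i j) → P.lagrangian x lam' α' ≤ P.lagrangian x lam α) ∧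
  ∀ x', P.lagrangian x lam α ≤ P.lagrangian x' lam α

/-- `H(ỹ) = ∑ᵢ fᵢ(yᵢ)`, where `ỹ = col(y₁, …, y_N)` and `yᵢ` is the copy of the joint decision
held by participant `i`. -/
def H (y : Fin N → Decision n) : ℝ := ∑ i, P.f i (y i)

variable (G : SimpleGraph (Fin N))

/-- The feasible set of the edge-based reformulation: `ỹ ∈ Ω̃`, `∑ᵢ Ãᵢ yᵢ = d`, and
`yᵢ = θₑ` for every edge `e` and each of its two endpoints `i`. A pair (edge, endpoint of it) is
encoded by the dart that starts at this endpoint and runs along this edge. -/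
def edgeFeasible : Set ((Fin N → Decision n) × (G.edgeSet → Decision n)) :=
  {p | (∀ i, p.1 i ∈ P.OmegaTilde i) ∧ ∑ i, P.Atilde i (p.1 i) = P.d ∧
    ∀ e : G.Dart, p.1 e.fst = p.2 ⟨e.edge, e.edge_mem⟩}

/-- `(ỹ, θ̃)` is an optimal solution of the edge-based reformulation:
it minimizes `H(ỹ)` over its feasible set. -/
def IsEdgeOptimal (y : Fin N → Decision n) (θ : G.edgeSet → Decision n) : Prop :=
  (y, θ) ∈ P.edgeFeasible G ∧ ∀ p ∈ P.edgeFeasible G, P.H y ≤ P.H p.1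

variable [DecidableRel G.Adj]

/-- The Lagrangian of the edge-based reformulation,
`H(ỹ) + λᵀ(∑ᵢ Ãᵢ yᵢ - d) + ∑_{e, i ∈ e} μ_{e,i}ᵀ (yᵢ - θₑ)`; the constraint `ỹ ∈ Ω̃` is not
dualized. -/
def edgeLagrangian (y : Fin N → Decision n) (θ : G.edgeSet → Decision n)
    (lam : EuclideanSpace ℝ (Fin n₀)) (μ : G.Dart → Decision n) : ℝ :=
  P.H y + ⟪lam, ∑ i, P.Atilde i (y i) - P.d⟫ +
    ∑ e : G.Dart, ⟪μ e, y e.fst - θ ⟨e.edge, e.edge_mem⟩⟫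

/-- `(ỹ, θ̃, λ, μ)` is a saddle point of the Lagrangian of the edge-based reformulation over
`ỹ ∈ Ω̃` and `θ̃`, `λ`, `μ` free. -/
def IsEdgeSaddle (y : Fin N → Decision n) (θ : G.edgeSet → Decision n)
    (lam : EuclideanSpace ℝ (Fin n₀)) (μ : G.Dart → Decision n) : Prop :=
  (∀ i, y i ∈ P.OmegaTilde i) ∧
  (∀ lam' μ', P.edgeLagrangian G y θ lam' μ' ≤ P.edgeLagrangian G y θ lam μ) ∧
  ∀ y' θ', (∀ i, y' i ∈ P.OmegaTilde i) →
    P.edgeLagrangian G y θ lam μ ≤ P.edgeLagrangian G y' θ' lam μ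

/-- The objective of the subproblem of participant `i`, given `γ = γᵢ(k)`, `l = lᵢ(k)`,
`v = vᵢ(k)` and the current copy `y₀ = yᵢ(k)`. -/
def subObjective (ρ σ : ℝ) (i : Fin N) (γ l : EuclideanSpace ℝ (Fin n₀)) (v y₀ : Decision n)
    (y : Decision n) : ℝ :=
  P.f i y + ρ / 2 * (G.degree i : ℝ) * ‖y - v‖ ^ 2 + ⟪l, P.Atilde i y⟫ +
    σ / 2 * ‖P.Atilde i y - P.Atilde i y₀ + γ‖ ^ 2

/-- The sequences `y`, `λ`, `η`, `v` are generated by Consensus-Tracking-ADMM with parameters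
`ρ`, `σ`, weight matrix `W` and communication graph `G`. Here `γᵢ(k) = ∑ₛ wᵢₛ ηₛ(k)`,
`lᵢ(k) = ∑ₛ wᵢₛ λₛ(k)` and `δₛ(k+1) = yₛ(k+1) - yₛ(k)/2`. -/
structure IsRun (W : Matrix (Fin N) (Fin N) ℝ) (ρ σ : ℝ)
    (y : ℕ → Fin N → Decision n) (lam eta : ℕ → Fin N → EuclideanSpace ℝ (Fin n₀))
    (v : ℕ → Fin N → Decision n) : Prop where
  init_y : ∀ i, y 0 i ∈ P.OmegaTilde i
  init_lam : ∀ i, lam 0 i = 0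
  init_eta : ∀ i, eta 0 i = P.Atilde i (y 0 i) - (N : ℝ)⁻¹ • P.d
  init_v : ∀ i, v 0 i =
    (G.degree i : ℝ)⁻¹ • ∑ j ∈ G.neighborFinset i, (1 / 2 : ℝ) • (y 0 i + y 0 j)
  step_y_mem : ∀ k i, y (k + 1) i ∈ P.OmegaTilde i
  step_y_min : ∀ k i,
    IsMinOn (P.subObjective G ρ σ i (∑ s, W i s • eta k s) (∑ s, W i s • lam k s) (v k i) (y k i))
      (P.OmegaTilde i) (y (k + 1) i)
  step_eta : ∀ k i, eta (k + 1) i =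
    ∑ s, W i s • eta k s + P.Atilde i (y (k + 1) i) - P.Atilde i (y k i)
  step_lam : ∀ k i, lam (k + 1) i = ∑ s, W i s • lam k s + σ • eta (k + 1) i
  step_v : ∀ k i, v (k + 1) i =
    v k i + (G.degree i : ℝ)⁻¹ • ∑ s ∈ G.neighborFinset i, (y (k + 1) s - (1 / 2 : ℝ) • y k s)
      - (1 / 2 : ℝ) • y k i

end Problem

/-- The communication graph is connected, and the weight matrix is adapted to it, symmetric,
doubly stochastic (with nonnegative entries) and positive semidefinite. -/
structure IsCommNetwork {N : ℕ} (G : SimpleGraph (Fin N)) (W : Matrix (Fin N) (Fin N) ℝ) :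
    Prop where
  connected : G.Connected
  diag_pos : ∀ i, 0 < W i i
  pos_iff : ∀ i j, i ≠ j → (0 < W i j ↔ G.Adj i j)
  symm : W.IsSymm
  doublyStochastic : W ∈ doublyStochastic ℝ (Fin N)
  posSemidef : W.PosSemidef

end CTADMM

end

/-! The method is consensus ADMM for the copies combined with a tracking recursion for the
multipliers, and one Lyapunov function handles both.

The saddle point minimizes a sum of convex local functions. The subgradient sum rule
`exists_subgradients_sum_eq_zero` splits its optimality condition into local subgradients with zero
sum, and connectedness turns that family into an antisymmetric flow on the darts. This flow is the
consensus multiplier, so the reformulation has a consensual point satisfying `IsKKT`.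

Along a run, put θ_e(k) = ½(y_i(k) + y_j(k)) and let μ_e(k) accumulate (ρ/2)(y_i - y_j). Then v_i is
the average over incident darts of θ_e - ρ⁻¹μ_e, and the optimality condition of each subproblem
involves only λ_i(k+1), μ_e(k+1) and θ_e(k+1) - θ_e(k) (`IsRun.variational_inequality`). Adding it
to the KKT inequality cancels the costs. The consensus terms then telescope exactly
(`consensus_energy_step`).

For the tracking terms, let b be the multiplier errors and choose r with (1 - W)r = σ(E - Wη) - (1 -
W)b, where E is the coupling error. Such r exists because the trackers preserve the total residual,
and it obeys r(k+1) = r(k) + (1 - W)b(k). Since W and 1 - W are positive, ⟨b, Wb⟩ plus the squared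
norm of the next r decreases up to the coupling term (`tracking_energy_step`).

Hence the dissipation is summable and the iterates are bounded, and every limit point obtained
satisfies `IsKKT`. Taking this limit point as the new reference, the Lyapunov function is
nonincreasing and tends to zero along a subsequence, so it tends to zero along the whole run. -/

noncomputable section

namespace CTADMM

/-! ### Mixing by the weight matrix and its Laplacian -/

section Mixing

variable {N : ℕ} {E : Type*} [NormedAddCommGroup E] [InnerProductSpace ℝ E]

/-- The action `(W x)ᵢ = ∑ₛ wᵢₛ xₛ` of a matrix on vector-valued families. -/
def mix (W : Matrix (Fin N) (Fin N) ℝ) :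
    PiLp 2 (fun _ : Fin N => E) →ₗ[ℝ] PiLp 2 (fun _ : Fin N => E) where
  toFun x := WithLp.toLp 2 (fun i => ∑ s, W i s • x s)
  map_add' x z := by
    ext i
    simp [smul_add, Finset.sum_add_distrib]
  map_smul' c x := by
    ext i
    simp [Finset.smul_sum, smul_comm c]

@[simp]
theorem mix_apply (W : Matrix (Fin N) (Fin N) ℝ) (x : PiLp 2 (fun _ : Fin N => E)) (i : Fin N) :
    mix W x i = ∑ s, W i s • x s := rfl

theorem inner_mix_comm {W : Matrix (Fin N) (Fin N) ℝ} (hW : W.IsSymm)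
    (x z : PiLp 2 (fun _ : Fin N => E)) : ⟪mix W x, z⟫ = ⟪x, mix W z⟫ := by
  simp only [PiLp.inner_apply, mix_apply, sum_inner, inner_sum, inner_smul_left, inner_smul_right]
  rw [Finset.sum_comm]
  refine Finset.sum_congr rfl fun i _ => Finset.sum_congr rfl fun j _ => ?_
  rw [← hW.apply i j]
  simp

/-- Writing W as a sum of rank-one matrices v vᵀ turns the form into a sum of squared norms, so
scalar semidefiniteness passes to vector-valued families. -/
theorem inner_mix_nonneg {W : Matrix (Fin N) (Fin N) ℝ} (hW : W.PosSemidef)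
    (x : PiLp 2 (fun _ : Fin N => E)) : 0 ≤ ⟪x, mix W x⟫ := by
  obtain ⟨m, v, hv⟩ := Matrix.posSemidef_iff_eq_sum_vecMulVec.mp hW
  have hWv : ∀ i j, W i j = ∑ l, v l i * v l j := fun i j => by
    simp [hv, Matrix.sum_apply, Matrix.vecMulVec_apply]
  have : ⟪x, mix W x⟫ = ∑ l, ‖∑ i, v l i • x i‖ ^ 2 := by
    simp only [← real_inner_self_eq_norm_sq, PiLp.inner_apply, mix_apply, hWv, sum_inner,
      inner_sum, real_inner_smul_left, real_inner_smul_right, Finset.sum_mul]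
    conv_rhs => rw [Finset.sum_comm]
    refine Finset.sum_congr rfl fun i _ => ?_
    conv_rhs => rw [Finset.sum_comm]
    refine Finset.sum_congr rfl fun j _ => Finset.sum_congr rfl fun l _ => ?_
    rw [real_inner_comm]
    ring
  rw [this]
  positivity

/-- The Laplacian quadratic form of a doubly stochastic matrix. -/
theorem inner_sub_mix_eq {W : Matrix (Fin N) (Fin N) ℝ}
    (hd : W ∈ doublyStochastic ℝ (Fin N)) (x : PiLp 2 (fun _ : Fin N => E)) :
    ⟪x, x - mix W x⟫ = (1 / 2) * ∑ i, ∑ j, W i j * ‖x i - x j‖ ^ 2 := by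
  have h1 : ∀ i, ∑ j, W i j = 1 := fun i => sum_row_of_mem_doublyStochastic hd i
  have h2 : ∀ j, ∑ i, W i j = 1 := fun j => sum_col_of_mem_doublyStochastic hd j
  have e1 : ∑ i, ∑ j, W i j * ‖x i‖ ^ 2 = ∑ i, ‖x i‖ ^ 2 := by
    simp [← Finset.sum_mul, h1]
  have e2 : ∑ i, ∑ j, W i j * ‖x j‖ ^ 2 = ∑ i, ‖x i‖ ^ 2 := by
    rw [Finset.sum_comm]
    simp [← Finset.sum_mul, h2]
  have e3 : ⟪x, mix W x⟫ = ∑ i, ∑ j, W i j * ⟪x i, x j⟫ := by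
    simp [PiLp.inner_apply, inner_sum, inner_smul_right]
  have e4 : ⟪x, x⟫ = ∑ i, ‖x i‖ ^ 2 := by
    rw [PiLp.inner_apply]
    simp
  have e5 : ∑ i, ∑ j, W i j * ‖x i - x j‖ ^ 2 =
      ∑ i, ∑ j, W i j * ‖x i‖ ^ 2 - 2 * ∑ i, ∑ j, W i j * ⟪x i, x j⟫
        + ∑ i, ∑ j, W i j * ‖x j‖ ^ 2 := by
    simp only [Finset.mul_sum, ← Finset.sum_sub_distrib, ← Finset.sum_add_distrib]
    refine Finset.sum_congr rfl fun i _ => Finset.sum_congr rfl fun j _ => ?_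
    rw [norm_sub_sq_real]
    ring
  rw [inner_sub_right, e3, e4, e5, e1, e2]
  ring

theorem inner_sub_mix_nonneg {W : Matrix (Fin N) (Fin N) ℝ}
    (hd : W ∈ doublyStochastic ℝ (Fin N)) (x : PiLp 2 (fun _ : Fin N => E)) :
    0 ≤ ⟪x, x - mix W x⟫ := by
  rw [inner_sub_mix_eq hd]
  exact mul_nonneg (by norm_num) (Finset.sum_nonneg fun i _ => Finset.sum_nonneg fun j _ =>
    mul_nonneg (nonneg_of_mem_doublyStochastic hd) (by positivity))

/-- The Laplacian form is a weighted sum of squared differences with positive weight on every edge;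
its vanishing propagates equality along walks. -/
theorem eq_of_inner_sub_mix_eq_zero {G : SimpleGraph (Fin N)} {W : Matrix (Fin N) (Fin N) ℝ}
    (hW : IsCommNetwork G W) {x : PiLp 2 (fun _ : Fin N => E)} (hx : ⟪x, x - mix W x⟫ = 0)
    (i j : Fin N) : x i = x j := by
  have hnn : ∀ i j, 0 ≤ W i j * ‖x i - x j‖ ^ 2 := fun i j =>
    mul_nonneg (nonneg_of_mem_doublyStochastic hW.doublyStochastic) (by positivity)
  rw [inner_sub_mix_eq hW.doublyStochastic] at hx
  have h0 : ∑ i, ∑ j, W i j * ‖x i - x j‖ ^ 2 = 0 := by linarith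
  rw [Finset.sum_eq_zero_iff_of_nonneg fun i _ => Finset.sum_nonneg fun j _ => hnn i j] at h0
  have hadj : ∀ i j, G.Adj i j → x i = x j := by
    intro i j hij
    have h1 := h0 i (Finset.mem_univ _)
    rw [Finset.sum_eq_zero_iff_of_nonneg fun j _ => hnn i j] at h1
    have h2 := h1 j (Finset.mem_univ _)
    have h3 : 0 < W i j := (hW.pos_iff i j hij.ne).2 hij
    rcases mul_eq_zero.1 h2 with h | h
    · exact absurd h h3.ne'
    · exact sub_eq_zero.1 (norm_eq_zero.1 (pow_eq_zero_iff (by norm_num) |>.1 h))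
  obtain ⟨p⟩ := hW.connected.preconnected i j
  induction p with
  | nil => rfl
  | cons h _ ih => exact (hadj _ _ h).trans ih

theorem sum_mix {W : Matrix (Fin N) (Fin N) ℝ} (hd : W ∈ doublyStochastic ℝ (Fin N))
    (x : PiLp 2 (fun _ : Fin N => E)) : ∑ i, mix W x i = ∑ i, x i := by
  simp only [mix_apply]
  rw [Finset.sum_comm]
  simp [← Finset.sum_smul, sum_col_of_mem_doublyStochastic hd]

theorem mix_const {W : Matrix (Fin N) (Fin N) ℝ} (hd : W ∈ doublyStochastic ℝ (Fin N)) (c : E) :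
    mix W (WithLp.toLp 2 fun _ => c) = WithLp.toLp 2 fun _ => c := by
  ext i
  simp [← Finset.sum_smul, sum_row_of_mem_doublyStochastic hd]

/-- The Laplacian `1 - W` has a pseudo-inverse: a linear map that inverts it on zero-sum families
and recovers any family up to its mean. -/
theorem exists_laplacian_pseudoinverse [FiniteDimensional ℝ E] {G : SimpleGraph (Fin N)}
    {W : Matrix (Fin N) (Fin N) ℝ} (hW : IsCommNetwork G W) :
    ∃ B : PiLp 2 (fun _ : Fin N => E) →ₗ[ℝ] PiLp 2 (fun _ : Fin N => E),
      (∀ x, ∑ i, x i = 0 → B x - mix W (B x) = x) ∧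
      ∀ x i, B (x - mix W x) i = x i - (N : ℝ)⁻¹ • ∑ s, x s := by
  have hN : (N : ℝ) ≠ 0 := by
    obtain ⟨i⟩ := hW.connected.nonempty
    exact_mod_cast (Fin.pos i).ne'
  set J : PiLp 2 (fun _ : Fin N => E) →ₗ[ℝ] PiLp 2 (fun _ : Fin N => E) :=
    mix (Matrix.of fun _ _ => (N : ℝ)⁻¹) with hJ
  have J_apply : ∀ x i, J x i = (N : ℝ)⁻¹ • ∑ s, x s := fun x i => by
    simp [hJ, Finset.smul_sum]
  have sum_J : ∀ x, ∑ i, J x i = ∑ i, x i := fun x => by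
    simp only [J_apply, Finset.sum_const, Finset.card_univ, Fintype.card_fin]
    rw [← Nat.cast_smul_eq_nsmul ℝ, smul_smul, mul_inv_cancel₀ hN, one_smul]
  -- Adding the averaging operator J to 1 - W removes the kernel of constant families without
  -- changing the action on zero-sum families. The inverse of T serves as B.
  set T : PiLp 2 (fun _ : Fin N => E) →ₗ[ℝ] PiLp 2 (fun _ : Fin N => E) :=
    LinearMap.id - mix W + J with hT
  have T_apply : ∀ x, T x = x - mix W x + J x := fun x => rfl
  have sum_T : ∀ x, ∑ i, T x i = ∑ i, x i := fun x => by
    simp only [T_apply, PiLp.add_apply, PiLp.sub_apply, Finset.sum_add_distrib,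
      Finset.sum_sub_distrib, sum_mix hW.doublyStochastic, sum_J]
    abel
  have inj : Function.Injective T := by
    rw [← LinearMap.ker_eq_bot, LinearMap.ker_eq_bot']
    intro x hx
    have hsum : ∑ i, x i = 0 := by
      rw [← sum_T, hx]
      simp
    have hJx : J x = 0 := by
      ext i
      rw [J_apply, hsum]
      simp
    have hx' : ⟪x, x - mix W x⟫ = 0 := by
      rw [T_apply, hJx, add_zero] at hx
      rw [hx, inner_zero_right]
    have hc := eq_of_inner_sub_mix_eq_zero hW hx'
    ext i
    have : (N : ℝ) • x i = 0 := by
      rw [← hsum, Finset.sum_congr rfl fun j _ => hc j i]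
      simp [Nat.cast_smul_eq_nsmul]
    simpa [hN] using this
  set e := LinearEquiv.ofInjectiveEndo T inj
  have e_apply : ∀ x, e x = T x := fun x => rfl
  refine ⟨e.symm, fun x hx => ?_, fun x i => ?_⟩
  · have h1 : T (e.symm x) = x := e.apply_symm_apply x
    have h2 : J (e.symm x) = 0 := by
      ext i
      rw [J_apply, ← sum_T, h1, hx]
      simp
    rw [T_apply, h2, add_zero] at h1
    exact h1
  -- WJ = J and J² = J give T(x - Jx) = x - Wx.
  · have h1 : x - mix W x = e (x - J x) := by
      have hJc : mix W (J x) = J x := by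
        have : J x = WithLp.toLp 2 fun _ => (N : ℝ)⁻¹ • ∑ s, x s := by
          ext i
          rw [J_apply]
        rw [this, mix_const hW.doublyStochastic]
      have hJJ : J (J x) = J x := by
        ext i
        rw [J_apply, sum_J, J_apply]
      rw [e_apply, T_apply, map_sub, map_sub, hJc, hJJ]
      abel
    change e.symm (x - mix W x) i = _
    rw [h1, e.symm_apply_apply, PiLp.sub_apply, J_apply]

theorem continuous_of_linearMap_piLp [FiniteDimensional ℝ E]
    (T : PiLp 2 (fun _ : Fin N => E) →ₗ[ℝ] PiLp 2 (fun _ : Fin N => E)) : Continuous T :=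
  T.continuous_of_finiteDimensional

end Mixing

/-! ### Energy estimate for the tracking recursion -/

section TrackingEnergy

variable {X : Type*} [NormedAddCommGroup X] [InnerProductSpace ℝ X]

/-- If `S` and `1 - S` are positive, then so is `S (1 - S)`. -/
theorem norm_sq_le_inner_of_isSymmetric {S : X →ₗ[ℝ] X} (hs : ∀ x z, ⟪S x, z⟫ = ⟪x, S z⟫)
    (h0 : ∀ x, 0 ≤ ⟪x, S x⟫) (h1 : ∀ x, 0 ≤ ⟪x, x - S x⟫) (x : X) :
    ‖S x‖ ^ 2 ≤ ⟪x, S x⟫ := by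
  -- S(1 - S) = S(1 - S)² + S²(1 - S): the first summand is positivity of S at x - Sx, the second is
  -- positivity of 1 - S at Sx.
  have a := h0 (x - S x)
  have b := h1 (S x)
  have c := hs x x
  have d := hs x (S x)
  have e := hs (S x) x
  have f := hs (S x) (S x)
  rw [← real_inner_self_eq_norm_sq]
  simp only [map_sub, inner_sub_left, inner_sub_right] at a b
  have g := real_inner_comm x (S x)
  linarith

/-- The same for `1 - S` in place of `S`. -/
theorem norm_sub_sq_le_inner_of_isSymmetric {S : X →ₗ[ℝ] X} (hs : ∀ x z, ⟪S x, z⟫ = ⟪x, S z⟫)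
    (h0 : ∀ x, 0 ≤ ⟪x, S x⟫) (h1 : ∀ x, 0 ≤ ⟪x, x - S x⟫) (x : X) :
    ‖x - S x‖ ^ 2 ≤ ⟪x, x - S x⟫ := by
  have := norm_sq_le_inner_of_isSymmetric (S := LinearMap.id - S)
    (fun x z => by simp [inner_sub_left, inner_sub_right, hs]) (by simpa using h1)
    (by simpa using h0) x
  simpa using this

/-- One-step energy estimate for the tracking recursion, where `a`, `b` are the new and the old
multiplier errors and `r` is the accumulated tracking error. -/
theorem tracking_energy_step {S : X →ₗ[ℝ] X} (hs : ∀ x z, ⟪S x, z⟫ = ⟪x, S z⟫)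
    (h0 : ∀ x, 0 ≤ ⟪x, S x⟫) (h1 : ∀ x, 0 ≤ ⟪x, x - S x⟫) (a b r : X) :
    -2 * ⟪a, (a - S b) + ((r + b) - S (r + b))⟫ ≤
      (⟪b, S b⟫ + ‖r + (b - S b)‖ ^ 2) - (⟪a, S a⟫ + ‖r + (b - S b) + (a - S a)‖ ^ 2)
        - (⟪a, a - S a⟫ + ‖S (a - b)‖ ^ 2) := by
  -- The terms in r and the cross terms in a, b cancel. The right side minus the left side equals
  -- 2(⟨a, Sa⟩ - ‖Sa‖²) + (⟨b, Sb⟩ - ‖Sb‖²).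
  have pa := norm_sq_le_inner_of_isSymmetric hs h0 h1 a
  have pb := norm_sq_le_inner_of_isSymmetric hs h0 h1 b
  have c1 := hs a r
  have c2 := hs a b
  have c3 := hs b a
  have c4 := hs b r
  have k1 := real_inner_comm a b
  have k2 := real_inner_comm (S a) b
  have k3 := real_inner_comm a (S b)
  have k4 := real_inner_comm (S a) (S b)
  have k5 := real_inner_comm a r
  have k6 := real_inner_comm b r
  have k7 := real_inner_comm (S a) r
  have k8 := real_inner_comm (S b) r
  have k9 := real_inner_comm (S a) a
  have k10 := real_inner_comm (S b) b
  simp only [← real_inner_self_eq_norm_sq, map_sub, map_add, inner_sub_left, inner_sub_right,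
    inner_add_left, inner_add_right] at *
  linarith

end TrackingEnergy

/-! ### Convex analysis: subgradient sum rule and first-order optimality -/

/-- Sum rule for subgradients at a minimizer: if `x` minimizes `∑ᵢ φᵢ`, there are subgradients of
the `φᵢ` at `x` that sum to zero. -/
theorem exists_subgradients_sum_eq_zero {ι F : Type*} [Fintype ι] [DecidableEq ι]
    [NormedAddCommGroup F] [InnerProductSpace ℝ F] [CompleteSpace F] {φ : ι → F → ℝ}
    (hc : ∀ i, ConvexOn ℝ Set.univ (φ i)) (hcont : ∀ i, Continuous (φ i)) {x : F}
    (hx : ∀ x', ∑ i, φ i x ≤ ∑ i, φ i x') :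
    ∃ s : ι → F, ∑ i, s i = 0 ∧ ∀ i y, φ i x + ⟪s i, y - x⟫ ≤ φ i y := by
  set m := ∑ i, φ i x with hm
  -- Give each φᵢ its own copy of the variable. Minimality says that the strict epigraph of the
  -- separable sum misses the diagonal at height m. A separating functional must vanish on the
  -- diagonal directions, and its components are the subgradients up to scale.
  let C : Set ((ι → F) × ℝ) := {p | ∑ i, φ i (p.1 i) < p.2}
  let D : Set ((ι → F) × ℝ) := {p | ∃ z : F, p = (fun _ => z, m)}
  have hCo : IsOpen C := isOpen_lt (by fun_prop) (by fun_prop)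
  have hCc : Convex ℝ C := by
    intro p hp q hq a b ha hb hab
    simp only [C, Set.mem_ofPred_eq, Prod.fst_add, Prod.smul_fst, Prod.snd_add, Prod.smul_snd,
      Pi.add_apply, Pi.smul_apply, smul_eq_mul] at *
    have h1 : ∑ i, φ i (a • p.1 i + b • q.1 i) ≤
        a * ∑ i, φ i (p.1 i) + b * ∑ i, φ i (q.1 i) := by
      rw [Finset.mul_sum, Finset.mul_sum, ← Finset.sum_add_distrib]
      exact Finset.sum_le_sum fun i _ =>
        (hc i).2 (Set.mem_univ _) (Set.mem_univ _) ha hb hab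
    rcases ha.eq_or_lt with rfl | ha'
    · obtain rfl : b = 1 := by linarith
      linarith
    · nlinarith [mul_lt_mul_of_pos_left hp ha', mul_le_mul_of_nonneg_left hq.le hb]
  have hDc : Convex ℝ D := by
    rintro p ⟨z, rfl⟩ q ⟨w, rfl⟩ a b ha hb hab
    refine ⟨a • z + b • w, Prod.ext rfl ?_⟩
    simp [← add_mul, hab]
  have hdisj : Disjoint C D := by
    rw [Set.disjoint_left]
    rintro p hp ⟨z, rfl⟩
    exact absurd (hx z) (not_le.2 hp)
  obtain ⟨L, u, hL1, hL2⟩ := geometric_hahn_banach_open hCc hCo hDc hdisj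
  let Li : ι → F →L[ℝ] ℝ := fun i =>
    (L.comp (ContinuousLinearMap.inl ℝ (ι → F) ℝ)).comp (ContinuousLinearMap.single ℝ (fun _ => F) i)
  set c := L (0, 1) with hcdef
  have L_apply : ∀ (w : ι → F) (t : ℝ), L (w, t) = ∑ i, Li i (w i) + t * c := by
    intro w t
    have h1 : (w, t) = (w, (0 : ℝ)) + t • ((0 : ι → F), (1 : ℝ)) := by simp
    have h2 : (w, (0 : ℝ)) = ∑ i, ((Pi.single i (w i) : ι → F), (0 : ℝ)) := by
      refine Prod.ext ?_ ?_
      · rw [Prod.fst_sum]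
        simp only
        exact (Finset.univ_sum_single w).symm
      · simp [Prod.snd_sum]
    rw [h1, map_add, map_smul, h2, map_sum]
    simp [Li, hcdef]
  have hzero : ∀ z, ∑ i, Li i z = 0 := by
    intro z
    by_contra hne
    have hb : ∀ t : ℝ, u ≤ t * ∑ i, Li i z + m * c := by
      intro t
      have := hL2 (fun _ => t • z, m) ⟨t • z, rfl⟩
      rw [L_apply] at this
      simpa [Finset.mul_sum] using this
    -- With this t the right side of the bound is u - 1.
    have := hb ((u - m * c - 1) / ∑ i, Li i z)
    rw [div_mul_cancel₀ _ hne] at this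
    linarith
  have hum : u ≤ m * c := by
    have := hL2 (fun _ => 0, m) ⟨0, rfl⟩
    rw [L_apply] at this
    simpa using this
  have hcneg : c < 0 := by
    have := hL1 (fun _ => x, m + 1) (by simp [C, ← hm])
    rw [L_apply, hzero] at this
    nlinarith
  have hsup : ∀ w : ι → F, ∑ i, Li i (w i) ≤ -c * (∑ i, φ i (w i) - m) := by
    intro w
    refine le_of_forall_pos_le_add fun ε hε => ?_
    -- The graph is only in the closure of the open epigraph; this height exceeds it by an amount
    -- that costs exactly ε.
    have := hL1 (w, ∑ i, φ i (w i) + ε / -c) (by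
      have : 0 < ε / -c := div_pos hε (by linarith)
      simp only [C, Set.mem_ofPred_eq]
      linarith)
    rw [L_apply, add_mul, div_mul_eq_mul_div, div_neg, mul_div_cancel_right₀ _ hcneg.ne] at this
    nlinarith
  refine ⟨fun i => (-c)⁻¹ • (InnerProductSpace.toDual ℝ F).symm (Li i), ?_, fun i y => ?_⟩
  · rw [← Finset.smul_sum, ← map_sum]
    have : ∑ i, Li i = 0 := by
      ext z
      simpa using hzero z
    rw [this, map_zero, smul_zero]
  -- Moving only the i-th copy away from x isolates the i-th subgradient inequality.
  · have h1 := hsup (Function.update (fun _ => x) i y)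
    have h2 : ∀ ψ : ι → F → ℝ, ∑ j, ψ j (Function.update (fun _ => x) i y j) =
        ∑ j, ψ j x + (ψ i y - ψ i x) := by
      intro ψ
      rw [← sub_eq_iff_eq_add', ← Finset.sum_sub_distrib, Finset.sum_eq_single i]
      · simp
      · intro j _ hj
        simp [Function.update_of_ne hj]
      · simp
    rw [h2 (fun i => Li i), h2 φ, hzero, ← hm] at h1
    rw [real_inner_smul_left, InnerProductSpace.toDual_symm_apply, map_sub]
    have h3 : (-c)⁻¹ * (Li i y - Li i x) ≤ φ i y - φ i x := by
      rw [inv_mul_le_iff₀ (by linarith)]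
      linarith
    linarith

theorem nonneg_of_forall_add_mul_sq_nonneg {a b : ℝ}
    (h : ∀ t : ℝ, 0 < t → t ≤ 1 → 0 ≤ t * a + t ^ 2 * b) : 0 ≤ a := by
  by_contra! ha
  -- This choice makes t|b| smaller than -a/2, so a + tb would be negative.
  set t := min 1 (-a / (2 * (|b| + 1))) with ht
  have hb : 0 < 2 * (|b| + 1) := by positivity
  have ht0 : 0 < t := lt_min one_pos (div_pos (by linarith) hb)
  have h1 := h t ht0 (min_le_left _ _)
  have h2 : t * (2 * (|b| + 1)) ≤ -a := (le_div_iff₀ hb).1 (min_le_right _ _)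
  have h3 : 0 ≤ t * (a + t * b) := by linarith
  have h4 : 0 ≤ a + t * b := nonneg_of_mul_nonneg_right h3 ht0
  nlinarith [mul_le_mul_of_nonneg_left (le_abs_self b) ht0.le]

/-- First-order optimality for a convex function plus two squared distances and a linear term. -/
theorem variational_inequality_of_isMinOn {F E : Type*} [NormedAddCommGroup F]
    [InnerProductSpace ℝ F] [NormedAddCommGroup E] [InnerProductSpace ℝ E] {f : F → ℝ}
    (hf : ConvexOn ℝ Set.univ f) {K : Set F} (hK : Convex ℝ K) (T : F →ₗ[ℝ] E) (c s : ℝ)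
    (v : F) (l w : E) {y : F} (hyK : y ∈ K)
    (hy : IsMinOn (fun z => f z + c / 2 * ‖z - v‖ ^ 2 + ⟪l, T z⟫ + s / 2 * ‖T z + w‖ ^ 2) K y)
    {z : F} (hz : z ∈ K) :
    0 ≤ f z - f y + c * ⟪y - v, z - y⟫ + ⟪l + s • (T y + w), T z - T y⟫ := by
  refine nonneg_of_forall_add_mul_sq_nonneg
    (b := c / 2 * ‖z - y‖ ^ 2 + s / 2 * ‖T z - T y‖ ^ 2) fun t ht0 ht1 => ?_
  have hmem : (1 - t) • y + t • z ∈ K := hK hyK hz (by linarith) ht0.le (by ring)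
  have hmin := isMinOn_iff.1 hy _ hmem
  have hfc := hf.2 (Set.mem_univ y) (Set.mem_univ z) (by linarith : 0 ≤ 1 - t) ht0.le (by ring)
  simp only [smul_eq_mul] at hfc
  have e1 : (1 - t) • y + t • z - v = (y - v) + t • (z - y) := by module
  have e2 : T ((1 - t) • y + t • z) = T y + t • (T z - T y) := by
    rw [map_add, map_smul, map_smul]
    module
  have e3 : T y + t • (T z - T y) + w = (T y + w) + t • (T z - T y) := by abel
  rw [e2, e1, e3, norm_add_sq_real (y - v), norm_add_sq_real (T y + w), norm_smul, norm_smul,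
    inner_add_right, real_inner_smul_right, real_inner_smul_right, real_inner_smul_right,
    Real.norm_of_nonneg ht0.le] at hmin
  rw [inner_add_left, real_inner_smul_left]
  nlinarith

/-! ### Edge variables and edge multipliers of consensus ADMM -/

section EdgeVariables

variable {N : ℕ} {G : SimpleGraph (Fin N)} {F : Type*} [NormedAddCommGroup F]
  [InnerProductSpace ℝ F]

/-- The edge variable `θ_e`, the midpoint of the copies held by the endpoints of the edge. -/
def edgeMean (y : Fin N → F) (e : G.Dart) : F := (1 / 2 : ℝ) • (y e.fst + y e.snd)

/-- The multiplier `μ_e` accumulated by the consensus constraint along a dart. -/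
def edgeDual (ρ : ℝ) (y : ℕ → Fin N → F) (k : ℕ) (e : G.Dart) : F :=
  ∑ t ∈ Finset.range k, (ρ / 2) • (y (t + 1) e.fst - y (t + 1) e.snd)

theorem edgeDual_succ (ρ : ℝ) (y : ℕ → Fin N → F) (k : ℕ) (e : G.Dart) :
    edgeDual ρ y (k + 1) e =
      edgeDual ρ y k e + (ρ / 2) • (y (k + 1) e.fst - y (k + 1) e.snd) :=
  Finset.sum_range_succ _ _

theorem edgeDual_symm (ρ : ℝ) (y : ℕ → Fin N → F) (k : ℕ) (e : G.Dart) :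
    edgeDual ρ y k e.symm = -edgeDual ρ y k e := by
  rw [edgeDual, edgeDual, ← Finset.sum_neg_distrib]
  refine Finset.sum_congr rfl fun t _ => ?_
  rw [← smul_neg, neg_sub]
  rfl

end EdgeVariables

/-! ### Sums over darts and the consensus energy identity -/

section Darts

variable {N : ℕ} (G : SimpleGraph (Fin N)) [DecidableRel G.Adj]

/-- The darts starting at a vertex. -/
def outDarts (i : Fin N) : Finset G.Dart := Finset.univ.filter fun e => e.fst = i

theorem sum_outDarts {M : Type*} [AddCommMonoid M] (i : Fin N) (h : Fin N → M) :
    ∑ e ∈ outDarts G i, h e.snd = ∑ j ∈ G.neighborFinset i, h j := by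
  refine Finset.sum_bij' (fun e _ => e.snd) (fun j hj => ⟨(i, j), (G.mem_neighborFinset i j).1 hj⟩)
    ?_ ?_ ?_ ?_ ?_
  · intro e he
    simp only [outDarts, Finset.mem_filter] at he
    rw [SimpleGraph.mem_neighborFinset, ← he.2]
    exact e.adj
  · intro j hj
    simp [outDarts]
  · intro e he
    simp only [outDarts, Finset.mem_filter] at he
    exact SimpleGraph.Dart.ext _ _ (Prod.ext he.2.symm rfl)
  · intro j hj
    rfl
  · intro e he
    rfl

theorem card_outDarts (i : Fin N) : (outDarts G i).card = G.degree i := by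
  have := sum_outDarts G i (fun _ => 1)
  simpa using this

theorem sum_sum_outDarts {M : Type*} [AddCommMonoid M] (h : Fin N → G.Dart → M) :
    ∑ i, ∑ e ∈ outDarts G i, h i e = ∑ e, h e.fst e := by
  rw [← Finset.sum_fiberwise Finset.univ (fun e : G.Dart => e.fst) (fun e => h e.fst e)]
  refine Finset.sum_congr rfl fun i _ => Finset.sum_congr rfl fun e he => ?_
  rw [(Finset.mem_filter.1 he).2]

theorem sum_dart_symm {M : Type*} [AddCommMonoid M] (h : G.Dart → M) :
    ∑ e : G.Dart, h e.symm = ∑ e, h e :=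
  Equiv.sum_comp (SimpleGraph.Dart.symm_involutive (G := G)).toPerm h

/-- Energy identity of the consensus part of a step; `m₀`, `m₁` are multiplier errors. -/
theorem consensus_energy_step {F : Type*} [NormedAddCommGroup F] [InnerProductSpace ℝ F] {ρ : ℝ} (hρ : 0 < ρ) (x : F) (y₀ y₁ : Fin N → F)
    (m₀ m₁ : G.Dart → F) (hanti : ∀ e, m₁ e.symm = -m₁ e)
    (hstep : ∀ e : G.Dart, m₁ e = m₀ e + (ρ / 2) • (y₁ e.fst - y₁ e.snd)) :
    2 * ∑ e : G.Dart, ⟪m₁ e + ρ • (edgeMean y₁ e - edgeMean y₀ e), x - y₁ e.fst⟫ =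
      ∑ e : G.Dart, (ρ⁻¹ * ‖m₀ e‖ ^ 2 + ρ * ‖edgeMean y₀ e - x‖ ^ 2) -
      ∑ e : G.Dart, (ρ⁻¹ * ‖m₁ e‖ ^ 2 + ρ * ‖edgeMean y₁ e - x‖ ^ 2) -
      ∑ e : G.Dart, (ρ⁻¹ * ‖m₁ e - m₀ e‖ ^ 2 + ρ * ‖edgeMean y₁ e - edgeMean y₀ e‖ ^ 2) := by
  have hsym : ∀ (u : Fin N → F) (e : G.Dart), edgeMean u e.symm = edgeMean u e := fun u e => by
    simp [edgeMean, add_comm]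
  -- Each dart is paired with its reversal: the multiplier changes sign, the midpoint does not, and
  -- the endpoint copies are midpoint ± ρ⁻¹(m₁ - m₀). The mixed terms cancel, leaving two
  -- polarization identities.
  rw [two_mul]
  nth_rewrite 2 [← sum_dart_symm]
  rw [← Finset.sum_add_distrib, ← Finset.sum_sub_distrib, ← Finset.sum_sub_distrib]
  refine Finset.sum_congr rfl fun e _ => ?_
  rw [hsym, hsym, hanti]
  have h1 : y₁ e.fst - y₁ e.snd = (2 * ρ⁻¹) • (m₁ e - m₀ e) := by
    rw [hstep e, add_sub_cancel_left, smul_smul]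
    rw [show 2 * ρ⁻¹ * (ρ / 2) = 1 by field_simp, one_smul]
  have h2 : y₁ e.fst = edgeMean y₁ e + ρ⁻¹ • (m₁ e - m₀ e) := by
    have : y₁ e.fst = edgeMean y₁ e + (1 / 2 : ℝ) • (y₁ e.fst - y₁ e.snd) := by
      rw [edgeMean]
      module
    rw [this, h1]
    module
  have h3 : y₁ e.symm.fst = edgeMean y₁ e - ρ⁻¹ • (m₁ e - m₀ e) := by
    have : y₁ e.symm.fst = edgeMean y₁ e - (1 / 2 : ℝ) • (y₁ e.fst - y₁ e.snd) := by
      rw [edgeMean]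
      change y₁ e.snd = _
      module
    rw [this, h1]
    module
  rw [h2, h3]
  generalize edgeMean y₁ e = p
  generalize edgeMean y₀ e = q
  generalize m₁ e = a
  generalize m₀ e = b
  have hk : ρ⁻¹ * ρ = 1 := inv_mul_cancel₀ hρ.ne'
  have c1 := real_inner_comm a b
  have c2 := real_inner_comm p q
  have c3 := real_inner_comm p x
  have c4 := real_inner_comm q x
  simp only [← real_inner_self_eq_norm_sq, inner_sub_left, inner_sub_right, inner_add_left,
    inner_add_right, real_inner_smul_left, real_inner_smul_right, inner_neg_left, c1, c2, c3, c4]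
  ring

end Darts

/-! ### Linearity, convexity and continuity of the problem data -/

namespace Problem

variable {N n₀ : ℕ} {n q : Fin N → ℕ} (P : Problem N n₀ n q)

/-- `Ãᵢ` as a linear map. -/
def AtildeLin (i : Fin N) : Decision n →ₗ[ℝ] EuclideanSpace ℝ (Fin n₀) where
  toFun := P.Atilde i
  map_add' x z := by simp [Atilde]
  map_smul' c x := by simp [Atilde]

theorem continuous_Atilde (i : Fin N) : Continuous (P.Atilde i) :=
  (P.AtildeLin i).continuous_of_finiteDimensional

variable {P}

theorem ConvexCompact.convex_OmegaTilde (hP : P.ConvexCompact) (i : Fin N) :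
    Convex ℝ (P.OmegaTilde i) := by
  intro x hx z hz a b ha hb hab j
  have h := (hP.convex_g i j).2 (Set.mem_univ (x i)) (Set.mem_univ (z i)) ha hb hab
  have h1 : P.g i (x i) j ≤ 0 := hx j
  have h2 : P.g i (z i) j ≤ 0 := hz j
  simp only [smul_eq_mul] at h
  have : P.g i ((a • x + b • z) i) j ≤ a * P.g i (x i) j + b * P.g i (z i) j := h
  nlinarith [mul_nonneg ha (neg_nonneg.2 h1), mul_nonneg hb (neg_nonneg.2 h2)]

theorem ConvexCompact.isClosed_OmegaTilde (hP : P.ConvexCompact) (i : Fin N) :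
    IsClosed (P.OmegaTilde i) :=
  (hP.compact i).isClosed.preimage (PiLp.continuous_apply 2 _ i)

theorem ConvexCompact.continuous_f (hP : P.ConvexCompact) (i : Fin N) : Continuous (P.f i) :=
  continuousOn_univ.1 ((hP.convex_f i).continuousOn isOpen_univ)

end Problem

/-! ### Optimality conditions of the edge-based reformulation and their solvability -/

namespace Problem

variable {N n₀ : ℕ} {n q : Fin N → ℕ} (P : Problem N n₀ n q)
variable (G : SimpleGraph (Fin N)) [DecidableRel G.Adj]

/-- Optimality conditions of the edge-based reformulation at a consensual point: all copies and all
edge variables equal `x`. -/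
structure IsKKT (x : Decision n) (ls : EuclideanSpace ℝ (Fin n₀)) (μ : G.Dart → Decision n) :
    Prop where
  mem : ∀ i, x ∈ P.OmegaTilde i
  coupling : ∑ i, P.Atilde i x = P.d
  antisymm : ∀ e, μ e.symm = -μ e
  le : ∀ i, ∀ z ∈ P.OmegaTilde i, P.f i x ≤
    P.f i z + ∑ e ∈ outDarts G i, ⟪μ e, z - x⟫ + ⟪ls, P.Atilde i z - P.Atilde i x⟫

variable {P G}

/-- Antisymmetry of μ is stationarity in θ̃, so the edge variables drop out of the Lagrangian. The
remainder separates over participants, and the local inequalities add up. -/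
theorem IsKKT.isEdgeSaddle {x : Decision n} {ls : EuclideanSpace ℝ (Fin n₀)}
    {μ : G.Dart → Decision n} (h : P.IsKKT G x ls μ) :
    P.IsEdgeSaddle G (fun _ => x) (fun _ => x) ls μ := by
  have hL : ∀ ls' μ', P.edgeLagrangian G (fun _ => x) (fun _ => x) ls' μ' = P.H fun _ => x := by
    intro ls' μ'
    simp [edgeLagrangian, h.coupling]
  refine ⟨h.mem, fun ls' μ' => by rw [hL, hL], fun y' θ' hy' => ?_⟩
  rw [hL]
  -- A dart and its reversal share θ' and carry opposite multipliers, so the sum equals its own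
  -- negative.
  have hθ : ∑ e : G.Dart, ⟪μ e, θ' ⟨e.edge, e.edge_mem⟩ - x⟫ = 0 := by
    have h1 := sum_dart_symm G fun e : G.Dart => ⟪μ e, θ' ⟨e.edge, e.edge_mem⟩ - x⟫
    have h2 : ∑ e : G.Dart, ⟪μ e.symm, θ' ⟨e.symm.edge, e.symm.edge_mem⟩ - x⟫ =
        -∑ e : G.Dart, ⟪μ e, θ' ⟨e.edge, e.edge_mem⟩ - x⟫ := by
      rw [← Finset.sum_neg_distrib]
      refine Finset.sum_congr rfl fun e _ => ?_
      rw [h.antisymm, inner_neg_left]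
      congr 4
      exact Subtype.ext e.edge_symm
    linarith
  have hs := Finset.sum_le_sum fun i (_ : i ∈ Finset.univ) => h.le i (y' i) (hy' i)
  rw [Finset.sum_add_distrib, Finset.sum_add_distrib, sum_sum_outDarts, ← inner_sum,
    Finset.sum_sub_distrib, h.coupling] at hs
  have hsplit : ∑ e : G.Dart, ⟪μ e, y' e.fst - θ' ⟨e.edge, e.edge_mem⟩⟫ =
      ∑ e : G.Dart, ⟪μ e, y' e.fst - x⟫ := by
    rw [← sub_zero (∑ e : G.Dart, ⟪μ e, y' e.fst - x⟫), ← hθ, ← Finset.sum_sub_distrib]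
    refine Finset.sum_congr rfl fun e _ => ?_
    rw [← inner_sub_right]
    congr 1
    abel
  simp only [edgeLagrangian, H, hsplit]
  linarith

theorem IsKKT.isEdgeOptimal {x : Decision n} {ls : EuclideanSpace ℝ (Fin n₀)}
    {μ : G.Dart → Decision n} (h : P.IsKKT G x ls μ) :
    P.IsEdgeOptimal G (fun _ => x) (fun _ => x) := by
  refine ⟨⟨h.mem, h.coupling, fun _ => rfl⟩, fun p hp => ?_⟩
  have h1 := h.isEdgeSaddle.2.2 p.1 p.2 hp.1
  have h2 : P.edgeLagrangian G p.1 p.2 ls μ = P.H p.1 := by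
    have : ∀ e : G.Dart, p.1 e.fst - p.2 ⟨e.edge, e.edge_mem⟩ = 0 :=
      fun e => sub_eq_zero.2 (hp.2.2 e)
    simp [edgeLagrangian, hp.2.1, this]
  have h3 : P.edgeLagrangian G (fun _ => x) (fun _ => x) ls μ = P.H fun _ => x := by
    simp [edgeLagrangian, h.coupling]
  rwa [h2, h3] at h1

/-- A saddle point of the Lagrangian is primal feasible and complementary. -/
theorem IsSaddle.feasible_and_complementary {x : Decision n} {lam : EuclideanSpace ℝ (Fin n₀)}
    {α : (i : Fin N) → Fin (q i) → ℝ} (h : P.IsSaddle x lam α) :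
    ∑ i, P.Atilde i x = P.d ∧ (∀ i, x i ∈ P.Omega i) ∧ ∀ i j, α i j * P.g i (x i) j = 0 := by
  obtain ⟨hα, hmax, -⟩ := h
  have hc : ∑ i, P.Atilde i x - P.d = 0 := by
    -- Moving λ against the residual raises the Lagrangian by the squared residual. Below, raising
    -- one α by 1 tests feasibility, and α = 0 tests complementarity.
    have := hmax (lam - (∑ i, P.Atilde i x - P.d)) α hα
    simp only [lagrangian, inner_sub_left lam, real_inner_self_eq_norm_sq] at this
    have h0 : ‖∑ i, P.Atilde i x - P.d‖ ^ 2 ≤ 0 := by linarith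
    exact norm_eq_zero.1 (pow_eq_zero_iff two_ne_zero |>.1 (le_antisymm h0 (by positivity)))
  have hg : ∀ i j, P.g i (x i) j ≤ 0 := by
    intro i j
    have := hmax lam (Function.update α i (Function.update (α i) j (α i j + 1))) (by
      intro i' j'
      rcases eq_or_ne i' i with rfl | hi
      · rcases eq_or_ne j' j with rfl | hj
        · simpa using add_nonneg (hα i' j') zero_le_one
        · simpa [hj] using hα i' j'
      · simpa [hi] using hα i' j')
    simp only [lagrangian] at this
    have hdiff : ∑ i', ∑ j', (Function.update α i (Function.update (α i) j (α i j + 1))) i' j' *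
        P.g i' (x i') j' - ∑ i', ∑ j', α i' j' * P.g i' (x i') j' = P.g i (x i) j := by
      rw [← Finset.sum_sub_distrib, Finset.sum_eq_single i, ← Finset.sum_sub_distrib,
        Finset.sum_eq_single j]
      · simp
        ring
      · intro j' _ hj
        simp [hj]
      · simp
      · intro i' _ hi
        simp [hi]
      · simp
    linarith
  refine ⟨sub_eq_zero.1 hc, hg, ?_⟩
  have h0 : 0 ≤ ∑ i, ∑ j, α i j * P.g i (x i) j := by
    have := hmax lam (fun _ _ => 0) (fun _ _ => le_rfl)
    simp only [lagrangian] at this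
    simpa using this
  have hle : ∀ i j, α i j * P.g i (x i) j ≤ 0 := fun i j =>
    mul_nonpos_of_nonneg_of_nonpos (hα i j) (hg i j)
  have hle' : ∀ i ∈ Finset.univ, ∑ j, α i j * P.g i (x i) j ≤ 0 := fun i _ =>
    Finset.sum_nonpos fun j _ => hle i j
  have h1 := (Finset.sum_eq_zero_iff_of_nonpos hle').1 (le_antisymm (Finset.sum_nonpos hle') h0)
  intro i j
  exact (Finset.sum_eq_zero_iff_of_nonpos fun j _ => hle i j).1 (h1 i (Finset.mem_univ _)) j
    (Finset.mem_univ _)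

/-- Every zero-sum family is the divergence of an antisymmetric flow on a connected network. -/
theorem _root_.CTADMM.IsCommNetwork.exists_antisymm_flow {F : Type*} [NormedAddCommGroup F]
    [InnerProductSpace ℝ F] [FiniteDimensional ℝ F] {W : Matrix (Fin N) (Fin N) ℝ}
    (hW : IsCommNetwork G W) {s : Fin N → F} (hs : ∑ i, s i = 0) :
    ∃ μ : G.Dart → F, (∀ e, μ e.symm = -μ e) ∧ ∀ i, ∑ e ∈ outDarts G i, μ e = s i := by
  obtain ⟨B, hB, -⟩ := exists_laplacian_pseudoinverse (E := F) hW
  -- Solving (1 - W)t = s for a potential t gives the flow w_ij(t_i - t_j), whose divergence at i is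
  -- s_i.
  set t := B (WithLp.toLp 2 s) with ht
  have hBt : t - mix W t = WithLp.toLp 2 s := hB _ hs
  refine ⟨fun e => W e.fst e.snd • (t e.fst - t e.snd), fun e => ?_, fun i => ?_⟩
  · change W e.snd e.fst • (t e.snd - t e.fst) = _
    rw [hW.symm.apply, ← smul_neg, neg_sub]
  · have h1 : ∑ e ∈ outDarts G i, W e.fst e.snd • (t e.fst - t e.snd) =
        ∑ e ∈ outDarts G i, W i e.snd • (t i - t e.snd) := by
      refine Finset.sum_congr rfl fun e he => ?_
      rw [(Finset.mem_filter.1 he).2]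
    have h2 : s i = t i - ∑ j, W i j • t j := by
      have := congrArg (fun x : PiLp 2 (fun _ : Fin N => F) => x i) hBt
      simpa using this.symm
    rw [h1, sum_outDarts G i fun j => W i j • (t i - t j), h2]
    have h3 : ∑ j ∈ G.neighborFinset i, W i j • (t i - t j) = ∑ j, W i j • (t i - t j) := by
      refine Finset.sum_subset (Finset.subset_univ _) fun j _ hj => ?_
      rcases eq_or_ne i j with rfl | hij
      · simp
      · rw [SimpleGraph.mem_neighborFinset, ← hW.pos_iff i j hij, not_lt] at hj
        rw [le_antisymm hj (nonneg_of_mem_doublyStochastic hW.doublyStochastic), zero_smul]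
    rw [h3]
    simp only [smul_sub, Finset.sum_sub_distrib, ← Finset.sum_smul,
      sum_row_of_mem_doublyStochastic hW.doublyStochastic, one_smul]

/-- The Lagrangian at the saddle multipliers is a constant plus the sum of local functions φᵢ that
already contain the dualized constraints, so the sum rule applies without a constraint
qualification. The zero-sum subgradients, negated, become the divergence of μ. Complementarity at x
and the sign of αᵀg on Ωᵢ then remove α. -/
theorem exists_isKKT (hP : P.ConvexCompact) (hsaddle : ∃ x lam α, P.IsSaddle x lam α)
    {W : Matrix (Fin N) (Fin N) ℝ} (hW : IsCommNetwork G W) :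
    ∃ x ls μ, P.IsKKT G x ls μ := by
  obtain ⟨x, lam, α, h⟩ := hsaddle
  obtain ⟨hc, hx, hcomp⟩ := h.feasible_and_complementary
  let φ : Fin N → Decision n → ℝ := fun i z =>
    P.f i z - ⟪lam, P.Atilde i z⟫ + ∑ j, α i j * P.g i (z i) j
  have hφ : ∀ i, ConvexOn ℝ Set.univ (φ i) := by
    intro i
    refine ⟨convex_univ, fun z _ w _ a b ha hb hab => ?_⟩
    have h1 := (hP.convex_f i).2 (Set.mem_univ z) (Set.mem_univ w) ha hb hab
    have h2 : P.Atilde i (a • z + b • w) = a • P.Atilde i z + b • P.Atilde i w := by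
      change P.AtildeLin i _ = a • P.AtildeLin i z + b • P.AtildeLin i w
      simp
    have h3 : ∑ j, α i j * P.g i ((a • z + b • w) i) j ≤
        a * ∑ j, α i j * P.g i (z i) j + b * ∑ j, α i j * P.g i (w i) j := by
      rw [Finset.mul_sum, Finset.mul_sum, ← Finset.sum_add_distrib]
      refine Finset.sum_le_sum fun j _ => ?_
      have := mul_le_mul_of_nonneg_left
        ((hP.convex_g i j).2 (Set.mem_univ (z i)) (Set.mem_univ (w i)) ha hb hab) (h.1 i j)
      simp only [smul_eq_mul] at this
      refine this.trans (le_of_eq ?_)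
      ring
    simp only [φ, h2, inner_add_right, real_inner_smul_right, smul_eq_mul] at *
    linarith
  have hL : ∀ z, P.lagrangian z lam α = ∑ i, φ i z + ⟪lam, P.d⟫ := by
    intro z
    simp only [lagrangian, φ, Finset.sum_add_distrib, Finset.sum_sub_distrib, inner_sub_right,
      inner_sum]
    ring
  obtain ⟨s, hs0, hs⟩ := exists_subgradients_sum_eq_zero hφ
    (fun i => continuousOn_univ.1 ((hφ i).continuousOn isOpen_univ)) (x := x) fun x' => by
      have := h.2.2 x'
      rw [hL, hL] at this
      linarith
  obtain ⟨μ, hμ1, hμ2⟩ := hW.exists_antisymm_flow (G := G) (s := fun i => -s i) (by simp [hs0])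
  -- The two Lagrangians carry the coupling multiplier with opposite signs.
  refine ⟨x, -lam, μ, hx, hc, hμ1, fun i z hz => ?_⟩
  have h1 := hs i z
  rw [← sum_inner, hμ2]
  have h2 : ∑ j, α i j * P.g i (x i) j = 0 := Finset.sum_eq_zero fun j _ => hcomp i j
  have h3 : ∑ j, α i j * P.g i (z i) j ≤ 0 := Finset.sum_nonpos fun j _ =>
    mul_nonpos_of_nonneg_of_nonpos (h.1 i j) (hz j)
  simp only [φ] at h1
  rw [inner_neg_left, inner_neg_left, inner_sub_right lam]
  linarith

end Problem

theorem IsCommNetwork.degree_ne_zero {N : ℕ} (hN : 2 ≤ N) {G : SimpleGraph (Fin N)}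
    [DecidableRel G.Adj] {W : Matrix (Fin N) (Fin N) ℝ} (hW : IsCommNetwork G W) (i : Fin N) :
    (G.degree i : ℝ) ≠ 0 := by
  have : Nontrivial (Fin N) := Fin.nontrivial_iff_two_le.2 hN
  exact_mod_cast (hW.connected.preconnected.degree_pos_of_nontrivial i).ne'

/-! ### The iteration rewritten in edge variables -/

namespace Problem

variable {N n₀ : ℕ} {n q : Fin N → ℕ} {P : Problem N n₀ n q}
variable {G : SimpleGraph (Fin N)} [DecidableRel G.Adj] {W : Matrix (Fin N) (Fin N) ℝ} {ρ σ : ℝ}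
  {y : ℕ → Fin N → Decision n} {lam eta : ℕ → Fin N → EuclideanSpace ℝ (Fin n₀)}
  {v : ℕ → Fin N → Decision n}

theorem IsRun.mem_OmegaTilde (hrun : P.IsRun G W ρ σ y lam eta v) (k : ℕ) (i : Fin N) :
    y k i ∈ P.OmegaTilde i := by
  cases k with
  | zero => exact hrun.init_y i
  | succ k => exact hrun.step_y_mem k i

/-- The trackers sum to the violation of the coupling constraint. -/
theorem IsRun.sum_eta (hrun : P.IsRun G W ρ σ y lam eta v)
    (hd : W ∈ doublyStochastic ℝ (Fin N)) (hN : (N : ℝ) ≠ 0) (k : ℕ) :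
    ∑ i, eta k i = ∑ i, P.Atilde i (y k i) - P.d := by
  induction k with
  | zero =>
    simp only [hrun.init_eta, Finset.sum_sub_distrib, Finset.sum_const, Finset.card_univ,
      Fintype.card_fin]
    rw [← Nat.cast_smul_eq_nsmul ℝ, smul_smul, mul_inv_cancel₀ hN, one_smul]
  | succ k ih =>
    have := sum_mix hd (WithLp.toLp 2 (eta k))
    simp only [mix_apply] at this
    simp only [hrun.step_eta, Finset.sum_sub_distrib, Finset.sum_add_distrib, this, ih]
    abel

/-- The proximal center `vᵢ` in terms of edge variables and edge multipliers. -/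
theorem IsRun.degree_smul_v (hrun : P.IsRun G W ρ σ y lam eta v) (hρ : 0 < ρ) {i : Fin N}
    (hdeg : (G.degree i : ℝ) ≠ 0) (k : ℕ) :
    (G.degree i : ℝ) • v k i =
      ∑ e ∈ outDarts G i, (edgeMean (y k) e - ρ⁻¹ • edgeDual ρ y k e) := by
  have hconst : ∀ c : Decision n, (G.degree i : ℝ) • c = ∑ j ∈ G.neighborFinset i, c := by
    intro c
    rw [Finset.sum_const, SimpleGraph.card_neighborFinset_eq_degree, Nat.cast_smul_eq_nsmul]
  induction k with
  | zero =>
    rw [hrun.init_v, smul_smul, mul_inv_cancel₀ hdeg, one_smul,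
      ← sum_outDarts G i fun j => (1 / 2 : ℝ) • (y 0 i + y 0 j)]
    refine Finset.sum_congr rfl fun e he => ?_
    simp [edgeMean, edgeDual, (Finset.mem_filter.1 he).2]
  | succ k ih =>
    rw [hrun.step_v, smul_sub, smul_add, smul_smul, mul_inv_cancel₀ hdeg, one_smul, ih, hconst,
      ← sum_outDarts G i fun j => y (k + 1) j - (1 / 2 : ℝ) • y k j,
      ← sum_outDarts G i fun _ => (1 / 2 : ℝ) • y k i, ← Finset.sum_add_distrib,
      ← Finset.sum_sub_distrib]
    refine Finset.sum_congr rfl fun e he => ?_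
    have hi : e.fst = i := (Finset.mem_filter.1 he).2
    have hk : ρ⁻¹ * (ρ / 2) = 1 / 2 := by field_simp
    rw [edgeDual_succ, smul_add, smul_smul, hk, edgeMean, edgeMean, hi]
    module

/-- The optimality condition of the local subproblem in terms of edge variables. -/
theorem IsRun.variational_inequality (hP : P.ConvexCompact)
    (hrun : P.IsRun G W ρ σ y lam eta v) (hρ : 0 < ρ) {i : Fin N}
    (hdeg : (G.degree i : ℝ) ≠ 0) (k : ℕ) {z : Decision n} (hz : z ∈ P.OmegaTilde i) :
    0 ≤ P.f i z - P.f i (y (k + 1) i)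
      + ∑ e ∈ outDarts G i, ⟪edgeDual ρ y (k + 1) e
          + ρ • (edgeMean (y (k + 1)) e - edgeMean (y k) e), z - y (k + 1) i⟫
      + ⟪lam (k + 1) i, P.Atilde i z - P.Atilde i (y (k + 1) i)⟫ := by
  have hmin := hrun.step_y_min k i
  have h := variational_inequality_of_isMinOn (hP.convex_f i) (hP.convex_OmegaTilde i)
    (P.AtildeLin i) (ρ * G.degree i) σ (v k i) (∑ s, W i s • lam k s)
    (-P.Atilde i (y k i) + ∑ s, W i s • eta k s) (hrun.step_y_mem k i) (by
      refine (isMinOn_iff.2 fun w hw => ?_)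
      have := isMinOn_iff.1 hmin w hw
      simp only [subObjective] at this
      change P.f i (y (k + 1) i) + ρ * (G.degree i) / 2 * ‖y (k + 1) i - v k i‖ ^ 2 +
        ⟪_, P.Atilde i (y (k + 1) i)⟫ + σ / 2 * ‖P.Atilde i (y (k + 1) i) + _‖ ^ 2 ≤
        P.f i w + ρ * (G.degree i) / 2 * ‖w - v k i‖ ^ 2 +
        ⟪_, P.Atilde i w⟫ + σ / 2 * ‖P.Atilde i w + _‖ ^ 2
      simp only [← add_assoc, ← sub_eq_add_neg]
      rw [mul_div_right_comm]
      exact this) hz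
  -- The penalty is evaluated at the new tracker, so the total coupling multiplier in the optimality
  -- condition is the updated λᵢ.
  have h1 : ∑ s, W i s • lam k s + σ • (P.AtildeLin i (y (k + 1) i) +
      (-P.Atilde i (y k i) + ∑ s, W i s • eta k s)) = lam (k + 1) i := by
    rw [hrun.step_lam, hrun.step_eta]
    change _ + σ • (P.Atilde i (y (k + 1) i) + _) = _
    congr 2
    abel
  -- On each dart, ρ(yᵢ(k+1) - θ(k)) + μ(k) = μ(k+1) + ρ(θ(k+1) - θ(k)), because yᵢ - θ is half the
  -- difference across the edge.
  have h2 : (ρ * (G.degree i : ℝ)) * ⟪y (k + 1) i - v k i, z - y (k + 1) i⟫ =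
      ∑ e ∈ outDarts G i, ⟪edgeDual ρ y (k + 1) e
          + ρ • (edgeMean (y (k + 1)) e - edgeMean (y k) e), z - y (k + 1) i⟫ := by
    rw [← sum_inner, ← real_inner_smul_left]
    congr 1
    rw [mul_smul, smul_sub, hrun.degree_smul_v hρ hdeg k, ← card_outDarts,
      Nat.cast_smul_eq_nsmul, ← Finset.sum_const, ← Finset.sum_sub_distrib, Finset.smul_sum]
    refine Finset.sum_congr rfl fun e he => ?_
    have hi : e.fst = i := (Finset.mem_filter.1 he).2
    rw [edgeDual_succ, smul_sub, smul_sub, smul_smul, mul_inv_cancel₀ hρ.ne', edgeMean, edgeMean,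
      hi]
    module
  rw [h1, h2] at h
  exact h

/-! ### Lyapunov function and its decrease -/

section Lyapunov

variable (P) (W) (ρ σ) (y) (lam) (eta)

/-- The errors `Ãᵢ yᵢ(k) - Ãᵢ x` of the coupling terms. -/
def couplingError (x : Decision n) (k : ℕ) :
    PiLp 2 (fun _ : Fin N => EuclideanSpace ℝ (Fin n₀)) :=
  WithLp.toLp 2 fun i => P.Atilde i (y k i) - P.Atilde i x

/-- The errors `λᵢ(k) - λ` of the multipliers. -/
def dualError (ls : EuclideanSpace ℝ (Fin n₀)) (k : ℕ) :
    PiLp 2 (fun _ : Fin N => EuclideanSpace ℝ (Fin n₀)) :=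
  WithLp.toLp 2 fun i => lam k i - ls

/-- The accumulated tracking error, where `B` is a pseudo-inverse of `1 - W`. -/
def trackingError (B : PiLp 2 (fun _ : Fin N => EuclideanSpace ℝ (Fin n₀)) →ₗ[ℝ]
    PiLp 2 (fun _ : Fin N => EuclideanSpace ℝ (Fin n₀))) (x : Decision n)
    (ls : EuclideanSpace ℝ (Fin n₀)) (k : ℕ) :
    PiLp 2 (fun _ : Fin N => EuclideanSpace ℝ (Fin n₀)) :=
  B (σ • (P.couplingError y x k - mix W (WithLp.toLp 2 (eta k))) -
    (dualError lam ls k - mix W (dualError lam ls k)))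

/-- The Lyapunov function of the iteration with respect to a point satisfying the optimality
conditions. -/
def lyapunov (B : PiLp 2 (fun _ : Fin N => EuclideanSpace ℝ (Fin n₀)) →ₗ[ℝ]
    PiLp 2 (fun _ : Fin N => EuclideanSpace ℝ (Fin n₀))) (x : Decision n)
    (ls : EuclideanSpace ℝ (Fin n₀)) (μ : G.Dart → Decision n) (k : ℕ) : ℝ :=
  σ⁻¹ * (⟪dualError lam ls k, mix W (dualError lam ls k)⟫ +
    ‖P.trackingError W σ y lam eta B x ls (k + 1)‖ ^ 2) +
  ∑ e : G.Dart, (ρ⁻¹ * ‖edgeDual ρ y k e - μ e‖ ^ 2 + ρ * ‖edgeMean (y k) e - x‖ ^ 2)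

variable (G) in
/-- The guaranteed decrease of the Lyapunov function in one step. -/
def dissipation (ls : EuclideanSpace ℝ (Fin n₀)) (k : ℕ) : ℝ :=
  σ⁻¹ * (⟪dualError lam ls (k + 1), dualError lam ls (k + 1) - mix W (dualError lam ls (k + 1))⟫ +
    ‖mix W (dualError lam ls (k + 1) - dualError lam ls k)‖ ^ 2) +
  ∑ e : G.Dart, (ρ⁻¹ * ‖edgeDual ρ y (k + 1) e - edgeDual ρ y k e‖ ^ 2 +
    ρ * ‖edgeMean (y (k + 1)) e - edgeMean (y k) e‖ ^ 2)

variable {P} {W} {ρ σ} {y} {lam} {eta}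

theorem IsRun.dualError_succ (hrun : P.IsRun G W ρ σ y lam eta v)
    (hd : W ∈ doublyStochastic ℝ (Fin N)) (ls : EuclideanSpace ℝ (Fin n₀)) (k : ℕ) :
    dualError lam ls (k + 1) =
      mix W (dualError lam ls k) + σ • WithLp.toLp 2 (eta (k + 1)) := by
  have h : dualError lam ls k = WithLp.toLp 2 (lam k) - WithLp.toLp 2 fun _ => ls := rfl
  rw [h, map_sub, mix_const hd]
  ext1 i
  simp only [dualError, PiLp.add_apply, PiLp.sub_apply, PiLp.smul_apply, mix_apply, hrun.step_lam]
  abel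

theorem IsRun.couplingError_succ (hrun : P.IsRun G W ρ σ y lam eta v) (x : Decision n) (k : ℕ) :
    P.couplingError y x (k + 1) = WithLp.toLp 2 (eta (k + 1)) +
      (P.couplingError y x k - mix W (WithLp.toLp 2 (eta k))) := by
  ext1 i
  simp only [couplingError, PiLp.add_apply, PiLp.sub_apply, mix_apply, hrun.step_eta]
  abel

variable {B : PiLp 2 (fun _ : Fin N => EuclideanSpace ℝ (Fin n₀)) →ₗ[ℝ]
    PiLp 2 (fun _ : Fin N => EuclideanSpace ℝ (Fin n₀))}

/-- The argument of B changes by (1 - W) applied to (1 - W)b. B undoes the outer factor up to a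
mean, and (1 - W)b has mean zero. -/
theorem IsRun.trackingError_succ (hrun : P.IsRun G W ρ σ y lam eta v)
    (hd : W ∈ doublyStochastic ℝ (Fin N))
    (hB : ∀ x i, B (x - mix W x) i = x i - (N : ℝ)⁻¹ • ∑ s, x s) (x : Decision n)
    (ls : EuclideanSpace ℝ (Fin n₀)) (k : ℕ) :
    P.trackingError W σ y lam eta B x ls (k + 1) =
      P.trackingError W σ y lam eta B x ls k +
        (dualError lam ls k - mix W (dualError lam ls k)) := by
  rw [← sub_eq_iff_eq_add', trackingError, trackingError, ← map_sub]
  set b := dualError lam ls k with hb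
  have harg : σ • (P.couplingError y x (k + 1) - mix W (WithLp.toLp 2 (eta (k + 1)))) -
      (dualError lam ls (k + 1) - mix W (dualError lam ls (k + 1))) -
      (σ • (P.couplingError y x k - mix W (WithLp.toLp 2 (eta k))) - (b - mix W b)) =
      (b - mix W b) - mix W (b - mix W b) := by
    rw [hrun.dualError_succ hd, hrun.couplingError_succ, ← hb]
    simp only [map_add, map_sub, map_smul, smul_add, smul_sub]
    abel
  rw [harg]
  ext1 i
  rw [hB]
  simp only [PiLp.sub_apply, Finset.sum_sub_distrib, sum_mix hd]
  simp

/-- B inverts 1 - W only on zero-sum families; the argument is one because `IsRun.sum_eta` conserves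
the total residual and x satisfies the coupling constraint. -/
theorem IsRun.laplacian_trackingError (hrun : P.IsRun G W ρ σ y lam eta v)
    (hd : W ∈ doublyStochastic ℝ (Fin N)) (hN : (N : ℝ) ≠ 0)
    (hB : ∀ x, ∑ i, x i = 0 → B x - mix W (B x) = x) {x : Decision n}
    (hx : ∑ i, P.Atilde i x = P.d) (ls : EuclideanSpace ℝ (Fin n₀)) (k : ℕ) :
    P.trackingError W σ y lam eta B x ls k - mix W (P.trackingError W σ y lam eta B x ls k) =
      σ • (P.couplingError y x k - mix W (WithLp.toLp 2 (eta k))) -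
        (dualError lam ls k - mix W (dualError lam ls k)) := by
  refine hB _ ?_
  simp only [PiLp.sub_apply, PiLp.smul_apply, Finset.sum_sub_distrib, ← Finset.smul_sum,
    sum_mix hd]
  simp only [couplingError, Finset.sum_sub_distrib, hx, hrun.sum_eta hd hN, sub_self, smul_zero]

theorem IsRun.lyapunov_succ_add_dissipation_le (hP : P.ConvexCompact) (hW : IsCommNetwork G W)
    (hdeg : ∀ i, (G.degree i : ℝ) ≠ 0) (hρ : 0 < ρ) (hσ : 0 < σ)
    (hrun : P.IsRun G W ρ σ y lam eta v)
    (hB₁ : ∀ x, ∑ i, x i = 0 → B x - mix W (B x) = x)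
    (hB₂ : ∀ x i, B (x - mix W x) i = x i - (N : ℝ)⁻¹ • ∑ s, x s)
    {x : Decision n} {ls : EuclideanSpace ℝ (Fin n₀)} {μ : G.Dart → Decision n}
    (hk : P.IsKKT G x ls μ) (k : ℕ) :
    P.lyapunov W ρ σ y lam eta B x ls μ (k + 1) + dissipation G W ρ σ y lam ls k ≤
      P.lyapunov W ρ σ y lam eta B x ls μ k := by
  have hd := hW.doublyStochastic
  have hN : (N : ℝ) ≠ 0 := by
    obtain ⟨i⟩ := hW.connected.nonempty
    exact_mod_cast (Fin.pos i).ne'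
  set a := dualError lam ls (k + 1) with ha
  set b := dualError lam ls k with hb
  set r := P.trackingError W σ y lam eta B x ls k with hr
  -- The step's variational inequality tested at x is added to the KKT inequality tested at yᵢ(k+1);
  -- the cost values cancel.
  have hsum : 0 ≤ ∑ e : G.Dart, ⟪(edgeDual ρ y (k + 1) e - μ e)
      + ρ • (edgeMean (y (k + 1)) e - edgeMean (y k) e), x - y (k + 1) e.fst⟫ -
      ⟪a, P.couplingError y x (k + 1)⟫ := by
    have h1 : ∀ i, 0 ≤ ∑ e ∈ outDarts G i, ⟪(edgeDual ρ y (k + 1) e - μ e)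
        + ρ • (edgeMean (y (k + 1)) e - edgeMean (y k) e), x - y (k + 1) i⟫ -
        ⟪a i, P.couplingError y x (k + 1) i⟫ := by
      intro i
      have e1 := hrun.variational_inequality hP hρ (hdeg i) k (hk.mem i)
      have e2 := hk.le i _ (hrun.step_y_mem k i)
      have e3 : ∑ e ∈ outDarts G i, ⟪(edgeDual ρ y (k + 1) e - μ e)
          + ρ • (edgeMean (y (k + 1)) e - edgeMean (y k) e), x - y (k + 1) i⟫ =
          ∑ e ∈ outDarts G i, ⟪edgeDual ρ y (k + 1) e
          + ρ • (edgeMean (y (k + 1)) e - edgeMean (y k) e), x - y (k + 1) i⟫ +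
          ∑ e ∈ outDarts G i, ⟪μ e, y (k + 1) i - x⟫ := by
        rw [← Finset.sum_add_distrib]
        refine Finset.sum_congr rfl fun e _ => ?_
        rw [← neg_sub x (y (k + 1) i), inner_neg_right, ← sub_eq_add_neg, ← inner_sub_left]
        congr 1
        abel
      have e4 : ⟪a i, P.couplingError y x (k + 1) i⟫ =
          -⟪lam (k + 1) i, P.Atilde i x - P.Atilde i (y (k + 1) i)⟫ -
          ⟪ls, P.Atilde i (y (k + 1) i) - P.Atilde i x⟫ := by
        simp only [ha, dualError, couplingError]
        rw [← inner_neg_right, neg_sub, ← inner_sub_left]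
      rw [e3, e4]
      linarith
    have h2 := Finset.sum_nonneg fun i (_ : i ∈ Finset.univ) => h1 i
    rw [Finset.sum_sub_distrib, sum_sum_outDarts, ← PiLp.inner_apply] at h2
    exact h2
  have hcons := consensus_energy_step G hρ x (y k) (y (k + 1))
    (fun e => edgeDual ρ y k e - μ e) (fun e => edgeDual ρ y (k + 1) e - μ e)
    (fun e => by rw [edgeDual_symm, hk.antisymm]; abel)
    (fun e => by rw [edgeDual_succ]; abel)
  simp only [sub_sub_sub_cancel_right] at hcons
  have htrack := tracking_energy_step (inner_mix_comm hW.symm) (inner_mix_nonneg hW.posSemidef)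
    (inner_sub_mix_nonneg hd) a b r
  have hr1 : P.trackingError W σ y lam eta B x ls (k + 1) = r + (b - mix W b) :=
    hrun.trackingError_succ hd hB₂ x ls k
  have hr2 : P.trackingError W σ y lam eta B x ls (k + 1 + 1) =
      r + (b - mix W b) + (a - mix W a) := by
    rw [hrun.trackingError_succ hd hB₂ x ls (k + 1), hr1]
  -- The scaled coupling error in terms of a, b and r, in the form that `tracking_energy_step`
  -- bounds.
  have hcoup : (a - mix W b) + ((r + b) - mix W (r + b)) =
      σ • P.couplingError y x (k + 1) := by
    have h1 := hrun.laplacian_trackingError hd hN hB₁ hk.coupling ls k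
    rw [← hr, ← hb] at h1
    have h2 : (r + b) - mix W (r + b) = (r - mix W r) + (b - mix W b) := by
      rw [map_add]
      abel
    rw [h2, h1, ha, hrun.dualError_succ hd, hrun.couplingError_succ, ← hb]
    simp only [smul_add]
    abel
  rw [hcoup, real_inner_smul_right, ← hr2, ← hr1] at htrack
  have htrack' := mul_le_mul_of_nonneg_left htrack (inv_nonneg.2 hσ.le)
  have hcancel : σ⁻¹ * (-2 * (σ * ⟪a, P.couplingError y x (k + 1)⟫)) =
      -2 * ⟪a, P.couplingError y x (k + 1)⟫ := by
    field_simp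
  rw [hcancel] at htrack'
  simp only [lyapunov, dissipation, ← ha, ← hb]
  linarith

end Lyapunov

end Problem

/-! ### Convergence criteria and asymptotic consensus -/

theorem tendsto_zero_of_add_le_of_nonneg {V D : ℕ → ℝ} (hV : ∀ k, 0 ≤ V k) (hD : ∀ k, 0 ≤ D k)
    (h : ∀ k, V (k + 1) + D k ≤ V k) : Tendsto D atTop (𝓝 0) := by
  have hsum : ∀ m, ∑ k ∈ Finset.range m, D k + V m ≤ V 0 := by
    intro m
    induction m with
    | zero => simp
    | succ m ih =>
      rw [Finset.sum_range_succ]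
      linarith [h m]
  exact (summable_of_sum_range_le (c := V 0) hD fun m => by
    linarith [hsum m, hV m]).tendsto_atTop_zero

theorem tendsto_zero_of_antitone_of_subseq {V : ℕ → ℝ} (hV : ∀ k, 0 ≤ V k) (hanti : Antitone V)
    {φ : ℕ → ℕ} (hφ : Tendsto φ atTop atTop) (h : Tendsto (fun j => V (φ j)) atTop (𝓝 0)) :
    Tendsto V atTop (𝓝 0) := by
  have h1 := tendsto_atTop_ciInf hanti ⟨0, by rintro _ ⟨k, rfl⟩; exact hV k⟩
  rwa [tendsto_nhds_unique (h1.comp hφ) h] at h1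

theorem tendsto_zero_of_norm_sq_le {X : Type*} [NormedAddCommGroup X] {u : ℕ → X} {D : ℕ → ℝ}
    {c : ℝ} (hD : Tendsto D atTop (𝓝 0)) (h : ∀ k, ‖u k‖ ^ 2 ≤ c * D k) :
    Tendsto u atTop (𝓝 0) := by
  have h1 : Tendsto (fun k => ‖u k‖ ^ 2) atTop (𝓝 0) :=
    squeeze_zero (fun k => by positivity) h (by simpa using hD.const_mul c)
  rw [tendsto_zero_iff_norm_tendsto_zero]
  have h2 := h1.sqrt
  simpa using h2

section Consensus

variable {N : ℕ} {G : SimpleGraph (Fin N)} {F : Type*} [NormedAddCommGroup F]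
  [InnerProductSpace ℝ F]

/-- The copy at an endpoint in terms of the edge variable and the multiplier increment. -/
theorem fst_eq_edgeMean_add
    {ρ : ℝ} (hρ : 0 < ρ) (y : ℕ → Fin N → F) (k : ℕ) (e : G.Dart) :
    y (k + 1) e.fst =
      edgeMean (y (k + 1)) e + ρ⁻¹ • (edgeDual ρ y (k + 1) e - edgeDual ρ y k e) := by
  have hk : ρ⁻¹ * (ρ / 2) = 1 / 2 := by field_simp
  rw [edgeDual_succ, add_sub_cancel_left, smul_smul, hk, edgeMean]
  module

theorem tendsto_copy_sub (hG : G.Connected) {ρ : ℝ} (hρ : 0 < ρ)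
    {y : ℕ → Fin N → F}
    (h : ∀ e : G.Dart, Tendsto (fun k => edgeDual ρ y (k + 1) e - edgeDual ρ y k e) atTop (𝓝 0))
    (i j : Fin N) : Tendsto (fun k => y (k + 1) i - y (k + 1) j) atTop (𝓝 0) := by
  have hadj : ∀ i j, G.Adj i j → Tendsto (fun k => y (k + 1) i - y (k + 1) j) atTop (𝓝 0) := by
    intro i j hij
    have h1 := (h ⟨(i, j), hij⟩).const_smul (2 * ρ⁻¹)
    rw [smul_zero] at h1
    refine h1.congr fun k => ?_
    rw [edgeDual_succ, add_sub_cancel_left, smul_smul, show 2 * ρ⁻¹ * (ρ / 2) = 1 by field_simp,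
      one_smul]
  obtain ⟨p⟩ := hG.preconnected i j
  induction p with
  | nil => simp
  | cons hij _ ih => simpa using (hadj _ _ hij).add ih

end Consensus

/-! ### Boundedness, limit points and the vanishing Lyapunov function -/

namespace Problem

variable {N n₀ : ℕ} {n q : Fin N → ℕ} {P : Problem N n₀ n q}
variable {G : SimpleGraph (Fin N)} [DecidableRel G.Adj] {W : Matrix (Fin N) (Fin N) ℝ} {ρ σ : ℝ}
  {y : ℕ → Fin N → Decision n} {lam eta : ℕ → Fin N → EuclideanSpace ℝ (Fin n₀)}
  {v : ℕ → Fin N → Decision n}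
  {B : PiLp 2 (fun _ : Fin N => EuclideanSpace ℝ (Fin n₀)) →ₗ[ℝ]
    PiLp 2 (fun _ : Fin N => EuclideanSpace ℝ (Fin n₀))}
  {x : Decision n} {ls : EuclideanSpace ℝ (Fin n₀)} {μ : G.Dart → Decision n}

/-- Every part of the Lyapunov function is bounded by the whole. -/
theorem lyapunov_bounds (hW : IsCommNetwork G W) (hρ : 0 < ρ) (hσ : 0 < σ) (k : ℕ) :
    0 ≤ P.lyapunov W ρ σ y lam eta B x ls μ k ∧
    ⟪dualError lam ls k, mix W (dualError lam ls k)⟫ ≤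
      σ * P.lyapunov W ρ σ y lam eta B x ls μ k ∧
    (∀ e, ‖edgeDual ρ y k e - μ e‖ ^ 2 ≤ ρ * P.lyapunov W ρ σ y lam eta B x ls μ k) ∧
    ∀ e : G.Dart, ‖edgeMean (y k) e - x‖ ^ 2 ≤ ρ⁻¹ * P.lyapunov W ρ σ y lam eta B x ls μ k := by
  set V := P.lyapunov W ρ σ y lam eta B x ls μ k with hV
  set s := ⟪dualError lam ls k, mix W (dualError lam ls k)⟫ with hs
  have hs0 : 0 ≤ s := inner_mix_nonneg hW.posSemidef _
  have ht0 : 0 ≤ ‖P.trackingError W σ y lam eta B x ls (k + 1)‖ ^ 2 := by positivity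
  have hnn : ∀ e ∈ Finset.univ, 0 ≤ ρ⁻¹ * ‖edgeDual ρ y k e - μ e‖ ^ 2 +
      ρ * ‖edgeMean (y k) e - x‖ ^ 2 := fun e _ => by positivity
  have h2 := Finset.sum_nonneg hnn
  have hσ' : 0 < σ⁻¹ := inv_pos.2 hσ
  have h1 : 0 ≤ σ⁻¹ * (s + ‖P.trackingError W σ y lam eta B x ls (k + 1)‖ ^ 2) := by positivity
  rw [lyapunov, ← hs] at hV
  have he : ∀ e, ρ⁻¹ * ‖edgeDual ρ y k e - μ e‖ ^ 2 + ρ * ‖edgeMean (y k) e - x‖ ^ 2 ≤ V :=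
    fun e => by linarith [Finset.single_le_sum hnn (Finset.mem_univ e)]
  refine ⟨by linarith, ?_, fun e => ?_, fun e => ?_⟩
  · rw [← inv_mul_le_iff₀ hσ]
    nlinarith
  · rw [← inv_mul_le_iff₀ hρ]
    have : 0 ≤ ρ * ‖edgeMean (y k) e - x‖ ^ 2 := by positivity
    linarith [he e]
  · rw [le_inv_mul_iff₀ hρ]
    have : 0 ≤ ρ⁻¹ * ‖edgeDual ρ y k e - μ e‖ ^ 2 := by positivity
    linarith [he e]

/-- Every part of the dissipation is bounded by the whole. -/
theorem dissipation_bounds (hW : IsCommNetwork G W) (hρ : 0 < ρ) (hσ : 0 < σ) (k : ℕ) :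
    0 ≤ dissipation G W ρ σ y lam ls k ∧
    ⟪dualError lam ls (k + 1), dualError lam ls (k + 1) - mix W (dualError lam ls (k + 1))⟫ ≤
      σ * dissipation G W ρ σ y lam ls k ∧
    ‖mix W (dualError lam ls (k + 1) - dualError lam ls k)‖ ^ 2 ≤
      σ * dissipation G W ρ σ y lam ls k ∧
    (∀ e : G.Dart, ‖edgeDual ρ y (k + 1) e - edgeDual ρ y k e‖ ^ 2 ≤
      ρ * dissipation G W ρ σ y lam ls k) ∧
    ∀ e : G.Dart, ‖edgeMean (y (k + 1)) e - edgeMean (y k) e‖ ^ 2 ≤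
      ρ⁻¹ * dissipation G W ρ σ y lam ls k := by
  set D := dissipation G W ρ σ y lam ls k with hD
  set s := ⟪dualError lam ls (k + 1),
    dualError lam ls (k + 1) - mix W (dualError lam ls (k + 1))⟫ with hs
  have hs0 : 0 ≤ s := inner_sub_mix_nonneg hW.doublyStochastic _
  have ht0 : 0 ≤ ‖mix W (dualError lam ls (k + 1) - dualError lam ls k)‖ ^ 2 := by positivity
  have hnn : ∀ e ∈ (Finset.univ : Finset G.Dart),
      0 ≤ ρ⁻¹ * ‖edgeDual ρ y (k + 1) e - edgeDual ρ y k e‖ ^ 2 +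
      ρ * ‖edgeMean (y (k + 1)) e - edgeMean (y k) e‖ ^ 2 := fun e _ => by positivity
  have h2 := Finset.sum_nonneg hnn
  have hσ' : 0 < σ⁻¹ := inv_pos.2 hσ
  have h1 : 0 ≤ σ⁻¹ * (s + ‖mix W (dualError lam ls (k + 1) - dualError lam ls k)‖ ^ 2) := by
    positivity
  rw [dissipation, ← hs] at hD
  have he : ∀ e : G.Dart, ρ⁻¹ * ‖edgeDual ρ y (k + 1) e - edgeDual ρ y k e‖ ^ 2 +
      ρ * ‖edgeMean (y (k + 1)) e - edgeMean (y k) e‖ ^ 2 ≤ D :=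
    fun e => by linarith [Finset.single_le_sum hnn (Finset.mem_univ e)]
  refine ⟨by linarith, ?_, ?_, fun e => ?_, fun e => ?_⟩
  · rw [← inv_mul_le_iff₀ hσ]
    nlinarith
  · rw [← inv_mul_le_iff₀ hσ]
    nlinarith
  · rw [← inv_mul_le_iff₀ hρ]
    have : 0 ≤ ρ * ‖edgeMean (y (k + 1)) e - edgeMean (y k) e‖ ^ 2 := by positivity
    linarith [he e]
  · rw [le_inv_mul_iff₀ hρ]
    have : 0 ≤ ρ⁻¹ * ‖edgeDual ρ y (k + 1) e - edgeDual ρ y k e‖ ^ 2 := by positivity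
    linarith [he e]

/-- The quantities that vanish along a run with vanishing dissipation. -/
theorem IsRun.tendsto_of_dissipation (hW : IsCommNetwork G W) (hρ : 0 < ρ) (hσ : 0 < σ)
    (hrun : P.IsRun G W ρ σ y lam eta v)
    (hD : Tendsto (dissipation G W ρ σ y lam ls) atTop (𝓝 0)) :
    Tendsto (fun k => dualError lam ls (k + 1) - mix W (dualError lam ls (k + 1))) atTop (𝓝 0) ∧
    Tendsto (fun k => (WithLp.toLp 2 (eta (k + 1)) :
      PiLp 2 (fun _ : Fin N => EuclideanSpace ℝ (Fin n₀)))) atTop (𝓝 0) ∧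
    (∀ e : G.Dart, Tendsto (fun k => edgeDual ρ y (k + 1) e - edgeDual ρ y k e) atTop (𝓝 0)) ∧
    ∀ e : G.Dart, Tendsto (fun k => edgeMean (y (k + 1)) e - edgeMean (y k) e) atTop (𝓝 0) := by
  have hd := hW.doublyStochastic
  have hM : Tendsto (fun k => dualError lam ls (k + 1) - mix W (dualError lam ls (k + 1)))
      atTop (𝓝 0) :=
    tendsto_zero_of_norm_sq_le hD fun k =>
      (norm_sub_sq_le_inner_of_isSymmetric (inner_mix_comm hW.symm)
        (inner_mix_nonneg hW.posSemidef) (inner_sub_mix_nonneg hd) _).trans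
        (dissipation_bounds hW hρ hσ k).2.1
  have hS : Tendsto (fun k => mix W (dualError lam ls (k + 1) - dualError lam ls k))
      atTop (𝓝 0) :=
    tendsto_zero_of_norm_sq_le hD fun k => (dissipation_bounds hW hρ hσ k).2.2.1
  refine ⟨hM, ?_, fun e => tendsto_zero_of_norm_sq_le hD fun k =>
    (dissipation_bounds hW hρ hσ k).2.2.2.1 e, fun e => tendsto_zero_of_norm_sq_le hD fun k =>
    (dissipation_bounds hW hρ hσ k).2.2.2.2 e⟩
  -- With a, b the new and old dual errors, ση(k+1) = a - Wb = W(a - b) + (1 - W)a, and both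
  -- summands vanish.
  have h := (hS.add hM).const_smul σ⁻¹
  rw [add_zero, smul_zero] at h
  refine h.congr fun k => ?_
  rw [inv_smul_eq_iff₀ hσ.ne', ← sub_eq_iff_eq_add'.2 (hrun.dualError_succ hd ls k), map_sub]
  abel

/-- A limit point of a run satisfies the optimality conditions. -/
theorem IsRun.isKKT_of_subseq (hP : P.ConvexCompact) (hW : IsCommNetwork G W)
    (hdeg : ∀ i, (G.degree i : ℝ) ≠ 0) (hρ : 0 < ρ)
    (hrun : P.IsRun G W ρ σ y lam eta v) {φ : ℕ → ℕ}
    (hy : ∀ i, Tendsto (fun j => y (φ j + 1) i) atTop (𝓝 x))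
    (hlam : ∀ i, Tendsto (fun j => lam (φ j + 1) i) atTop (𝓝 ls))
    (hμ : ∀ e, Tendsto (fun j => edgeDual ρ y (φ j + 1) e) atTop (𝓝 (μ e)))
    (heta : ∀ i, Tendsto (fun j => eta (φ j + 1) i) atTop (𝓝 0))
    (hθ : ∀ e : G.Dart, Tendsto (fun j => edgeMean (y (φ j + 1)) e - edgeMean (y (φ j)) e)
      atTop (𝓝 0)) :
    P.IsKKT G x ls μ := by
  have hN : (N : ℝ) ≠ 0 := by
    obtain ⟨i⟩ := hW.connected.nonempty
    exact_mod_cast (Fin.pos i).ne'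
  have hA : ∀ i, Tendsto (fun j => P.Atilde i (y (φ j + 1) i)) atTop (𝓝 (P.Atilde i x)) :=
    fun i => ((P.continuous_Atilde i).tendsto x).comp (hy i)
  refine ⟨fun i => ?_, ?_, fun e => ?_, fun i z hz => ?_⟩
  · exact (hP.isClosed_OmegaTilde i).mem_of_tendsto (hy i)
      (Eventually.of_forall fun j => hrun.mem_OmegaTilde _ i)
  · have h1 := tendsto_finsetSum Finset.univ fun i _ => heta i
    have h2 := (tendsto_finsetSum Finset.univ fun i _ => hA i).sub_const P.d
    simp only [hrun.sum_eta hW.doublyStochastic hN, Finset.sum_const_zero] at h1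
    exact sub_eq_zero.1 (tendsto_nhds_unique h2 h1)
  · refine tendsto_nhds_unique (hμ e.symm) ((hμ e).neg.congr fun j => ?_)
    rw [edgeDual_symm]
  · have h1 : Tendsto (fun j => P.f i z - P.f i (y (φ j + 1) i)
        + ∑ e ∈ outDarts G i, ⟪edgeDual ρ y (φ j + 1) e
          + ρ • (edgeMean (y (φ j + 1)) e - edgeMean (y (φ j)) e), z - y (φ j + 1) i⟫
        + ⟪lam (φ j + 1) i, P.Atilde i z - P.Atilde i (y (φ j + 1) i)⟫) atTop
        (𝓝 (P.f i z - P.f i x + ∑ e ∈ outDarts G i, ⟪μ e + ρ • (0 : Decision n), z - x⟫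
          + ⟪ls, P.Atilde i z - P.Atilde i x⟫)) := by
      refine ((((hP.continuous_f i).tendsto x).comp (hy i)).const_sub _ |>.add
        (tendsto_finsetSum _ fun e _ => ?_)).add ((hlam i).inner ((hA i).const_sub _))
      exact ((hμ e).add ((hθ e).const_smul ρ)).inner ((hy i).const_sub z)
    have h2 := ge_of_tendsto' h1 fun j => hrun.variational_inequality hP hρ (hdeg i) (φ j) hz
    simp only [smul_zero, add_zero] at h2
    linarith

theorem exists_outDart {i : Fin N} (hdeg : (G.degree i : ℝ) ≠ 0) : ∃ e : G.Dart, e.fst = i := by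
  have : 0 < G.degree i := Nat.pos_of_ne_zero (by exact_mod_cast hdeg)
  obtain ⟨j, hj⟩ := (G.degree_pos_iff_exists_adj i).1 this
  exact ⟨⟨(i, j), hj⟩, rfl⟩

/-- A run has a limit point satisfying the optimality conditions. -/
theorem IsRun.exists_subseq_tendsto (hP : P.ConvexCompact) (hW : IsCommNetwork G W)
    (hdeg : ∀ i, (G.degree i : ℝ) ≠ 0) (hρ : 0 < ρ) (hσ : 0 < σ)
    (hrun : P.IsRun G W ρ σ y lam eta v)
    (hB₁ : ∀ x, ∑ i, x i = 0 → B x - mix W (B x) = x)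
    (hB₂ : ∀ x i, B (x - mix W x) i = x i - (N : ℝ)⁻¹ • ∑ s, x s)
    (hk : P.IsKKT G x ls μ) :
    ∃ (x' : Decision n) (ls' : EuclideanSpace ℝ (Fin n₀)) (μ' : G.Dart → Decision n) (φ : ℕ → ℕ),
      StrictMono φ ∧ P.IsKKT G x' ls' μ' ∧
      (∀ i, Tendsto (fun j => y (φ j + 1) i) atTop (𝓝 x')) ∧
      (∀ i, Tendsto (fun j => lam (φ j + 1) i) atTop (𝓝 ls')) ∧
      (∀ e, Tendsto (fun j => edgeDual ρ y (φ j + 1) e) atTop (𝓝 (μ' e))) := by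
  have hd := hW.doublyStochastic
  have hdec := hrun.lyapunov_succ_add_dissipation_le hP hW hdeg hρ hσ hB₁ hB₂ hk
  set V := P.lyapunov W ρ σ y lam eta B x ls μ with hV
  have hVb := lyapunov_bounds (P := P) (y := y) (lam := lam) (eta := eta) (B := B) (x := x)
    (ls := ls) (μ := μ) hW hρ hσ
  have hDb := dissipation_bounds (G := G) (y := y) (lam := lam) (ls := ls) hW hρ hσ
  rw [← hV] at hVb
  have hanti : Antitone V := antitone_nat_of_succ_le fun k => by linarith [hdec k, (hDb k).1]
  have hV0 : ∀ k, V k ≤ V 0 := fun k => hanti (Nat.zero_le k)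
  have hD0 : ∀ k, dissipation G W ρ σ y lam ls k ≤ V 0 := fun k => by
    linarith [hdec k, (hVb (k + 1)).1, hV0 k]
  obtain ⟨hM, heta, hμd, hθd⟩ := hrun.tendsto_of_dissipation hW hρ hσ
    (tendsto_zero_of_add_le_of_nonneg (fun k => (hVb k).1) (fun k => (hDb k).1) hdec)
  obtain ⟨i₀⟩ := hW.connected.nonempty
  obtain ⟨e₀, he₀⟩ := exists_outDart (hdeg i₀)
  -- Compactness of Ωᵢ bounds only the i-th block of yᵢ, so boundedness is taken from the Lyapunov
  -- function. One edge mean suffices, since the copies approach each other.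
  let z : ℕ → Decision n × PiLp 2 (fun _ : Fin N => EuclideanSpace ℝ (Fin n₀)) ×
      (G.Dart → Decision n) := fun k =>
    (edgeMean (y (k + 1)) e₀ - x, dualError lam ls (k + 1),
      fun e => edgeDual ρ y (k + 1) e - μ e)
  set R := √(ρ⁻¹ * V 0) + √(2 * (σ * V 0)) + √(ρ * V 0) with hR
  have hzR : ∀ k, z k ∈ Metric.closedBall 0 R := by
    intro k
    have b1 : ‖edgeMean (y (k + 1)) e₀ - x‖ ≤ √(ρ⁻¹ * V 0) :=
      Real.le_sqrt_of_sq_le (((hVb (k + 1)).2.2.2 e₀).trans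
        (mul_le_mul_of_nonneg_left (hV0 _) (inv_nonneg.2 hρ.le)))
    -- W may be singular, so V controls only ⟨b, Wb⟩. The dissipation of the preceding step supplies
    -- ⟨b, (1 - W)b⟩; the two bounds give the factor 2 and force the index k + 1.
    have b2 : ‖dualError lam ls (k + 1)‖ ≤ √(2 * (σ * V 0)) := by
      refine Real.le_sqrt_of_sq_le ?_
      have c1 := (hVb (k + 1)).2.1.trans (mul_le_mul_of_nonneg_left (hV0 _) hσ.le)
      have c2 := (hDb k).2.1.trans (mul_le_mul_of_nonneg_left (hD0 k) hσ.le)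
      rw [inner_sub_right, real_inner_self_eq_norm_sq] at c2
      linarith
    have b3 : ∀ e, ‖edgeDual ρ y (k + 1) e - μ e‖ ≤ √(ρ * V 0) := fun e =>
      Real.le_sqrt_of_sq_le (((hVb (k + 1)).2.2.1 e).trans
        (mul_le_mul_of_nonneg_left (hV0 _) hρ.le))
    have n1 := Real.sqrt_nonneg (ρ⁻¹ * V 0)
    have n2 := Real.sqrt_nonneg (2 * (σ * V 0))
    have n3 := Real.sqrt_nonneg (ρ * V 0)
    rw [mem_closedBall_zero_iff]
    refine norm_prod_le_iff.2 ⟨?_, norm_prod_le_iff.2 ⟨?_, ?_⟩⟩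
    · exact b1.trans (by linarith)
    · exact b2.trans (by linarith)
    · exact (pi_norm_le_iff_of_nonneg (by linarith)).2 fun e => (b3 e).trans (by linarith)
  obtain ⟨a, -, φ, hφ, hlim⟩ := tendsto_subseq_of_bounded Metric.isBounded_closedBall hzR
  have hφt := hφ.tendsto_atTop
  have l1 : Tendsto (fun j => edgeMean (y (φ j + 1)) e₀ - x) atTop (𝓝 a.1) :=
    (continuous_fst.tendsto a).comp hlim
  have l2 : Tendsto (fun j => dualError lam ls (φ j + 1)) atTop (𝓝 a.2.1) :=
    ((continuous_fst.comp continuous_snd).tendsto a).comp hlim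
  have l3 : Tendsto (fun j => fun e => edgeDual ρ y (φ j + 1) e - μ e) atTop (𝓝 a.2.2) :=
    ((continuous_snd.comp continuous_snd).tendsto a).comp hlim
  have hy₀ : Tendsto (fun j => y (φ j + 1) i₀) atTop (𝓝 (a.1 + x)) := by
    have h := (l1.add_const x).add (((hμd e₀).comp hφt).const_smul ρ⁻¹)
    rw [smul_zero, add_zero] at h
    refine h.congr fun j => ?_
    rw [← he₀, fst_eq_edgeMean_add hρ y, sub_add_cancel]
    rfl
  have hy : ∀ i, Tendsto (fun j => y (φ j + 1) i) atTop (𝓝 (a.1 + x)) := by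
    intro i
    have h := ((tendsto_copy_sub hW.connected hρ hμd i i₀).comp hφt).add hy₀
    rw [zero_add] at h
    exact h.congr fun j => by simp
  have hmix : Continuous (mix W : PiLp 2 (fun _ : Fin N => EuclideanSpace ℝ (Fin n₀)) →ₗ[ℝ] _) :=
    continuous_of_linearMap_piLp _
  have hcons : ∀ i j, a.2.1 i = a.2.1 j := by
    refine eq_of_inner_sub_mix_eq_zero hW ?_
    have h := l2.sub ((hmix.tendsto _).comp l2)
    rw [tendsto_nhds_unique h (hM.comp hφt), inner_zero_right]
  have hlam : ∀ i, Tendsto (fun j => lam (φ j + 1) i) atTop (𝓝 (a.2.1 i₀ + ls)) := by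
    intro i
    rw [hcons i₀ i]
    have h := (((PiLp.continuous_apply 2 _ i).tendsto a.2.1).comp l2).add_const ls
    exact h.congr fun j => by simp [dualError]
  have hμ : ∀ e, Tendsto (fun j => edgeDual ρ y (φ j + 1) e) atTop (𝓝 (a.2.2 e + μ e)) := by
    intro e
    have h := ((tendsto_pi_nhds.1 l3 e)).add_const (μ e)
    exact h.congr fun j => by simp
  refine ⟨a.1 + x, a.2.1 i₀ + ls, fun e => a.2.2 e + μ e, φ, hφ, ?_, hy, hlam, hμ⟩
  refine hrun.isKKT_of_subseq hP hW hdeg hρ hy hlam hμ (fun i => ?_) fun e => (hθd e).comp hφt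
  exact ((PiLp.continuous_apply 2 _ i).tendsto _).comp (heta.comp hφt)

/-- The Lyapunov function vanishes along a subsequence converging to its reference point. -/
theorem IsRun.tendsto_lyapunov_subseq (hW : IsCommNetwork G W) (hρ : 0 < ρ) (hσ : 0 < σ)
    (hrun : P.IsRun G W ρ σ y lam eta v)
    (hB₂ : ∀ x i, B (x - mix W x) i = x i - (N : ℝ)⁻¹ • ∑ s, x s)
    (hD : Tendsto (dissipation G W ρ σ y lam ls) atTop (𝓝 0)) {φ : ℕ → ℕ} (hφ : StrictMono φ)
    (hy : ∀ i, Tendsto (fun j => y (φ j + 1) i) atTop (𝓝 x))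
    (hlam : ∀ i, Tendsto (fun j => lam (φ j + 1) i) atTop (𝓝 ls))
    (hμ : ∀ e, Tendsto (fun j => edgeDual ρ y (φ j + 1) e) atTop (𝓝 (μ e))) :
    Tendsto (fun j => P.lyapunov W ρ σ y lam eta B x ls μ (φ j + 1)) atTop (𝓝 0) := by
  have hd := hW.doublyStochastic
  obtain ⟨hM, heta, -, -⟩ := hrun.tendsto_of_dissipation hW hρ hσ hD
  have hmix : Continuous (mix W : PiLp 2 (fun _ : Fin N => EuclideanSpace ℝ (Fin n₀)) →ₗ[ℝ] _) :=
    continuous_of_linearMap_piLp _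
  have hBc : Continuous B := continuous_of_linearMap_piLp _
  have hM' := hM.comp hφ.tendsto_atTop
  have heta' := (hmix.tendsto _).comp (heta.comp hφ.tendsto_atTop)
  have hL : Tendsto (fun j => dualError lam ls (φ j + 1)) atTop (𝓝 0) := by
    refine ((PiLp.continuous_toLp 2 _).tendsto (0 : Fin N → EuclideanSpace ℝ (Fin n₀))).comp
      (tendsto_pi_nhds.2 fun i => ?_)
    simpa using (hlam i).sub_const ls
  have hE : Tendsto (fun j => P.couplingError y x (φ j + 1)) atTop (𝓝 0) := by
    refine ((PiLp.continuous_toLp 2 _).tendsto (0 : Fin N → EuclideanSpace ℝ (Fin n₀))).comp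
      (tendsto_pi_nhds.2 fun i => ?_)
    simpa using (((P.continuous_Atilde i).tendsto x).comp (hy i)).sub_const (P.Atilde i x)
  -- The formula through the continuous map B makes the tracking error vanish with its inputs. The
  -- recursion reaches the next index, where convergence of y and λ is not assumed.
  have hT : Tendsto (fun j => P.trackingError W σ y lam eta B x ls (φ j + 1 + 1)) atTop (𝓝 0) := by
    have h := ((hBc.tendsto _).comp (((hE.sub heta').const_smul σ).sub hM')).add hM'
    simp only [map_zero, sub_zero, smul_zero, add_zero] at h
    refine h.congr fun j => ?_
    rw [hrun.trackingError_succ hd hB₂]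
    rfl
  have h1 := ((hL.inner ((hmix.tendsto _).comp hL)).add (hT.norm.pow 2)).const_mul σ⁻¹
  have h2 : Tendsto (fun j => ∑ e : G.Dart, (ρ⁻¹ * ‖edgeDual ρ y (φ j + 1) e - μ e‖ ^ 2 +
      ρ * ‖edgeMean (y (φ j + 1)) e - x‖ ^ 2)) atTop
      (𝓝 (∑ e : G.Dart, (ρ⁻¹ * ‖μ e - μ e‖ ^ 2 +
        ρ * ‖(1 / 2 : ℝ) • (x + x) - x‖ ^ 2))) := by
    refine tendsto_finsetSum _ fun e _ => ?_
    exact ((((hμ e).sub_const _).norm.pow 2).const_mul _).add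
      ((((((hy e.fst).add (hy e.snd)).const_smul (1 / 2 : ℝ)).sub_const x).norm.pow 2).const_mul ρ)
  have hxx : (1 / 2 : ℝ) • (x + x) - x = 0 := by module
  have h3 := h1.add h2
  simp only [sub_self, hxx, map_zero, inner_zero_right, norm_zero, zero_pow two_ne_zero, mul_zero,
    add_zero, Finset.sum_const_zero] at h3
  exact h3

end Problem

end CTADMM

end

/-! ### Convergence of the whole sequence -/

open CTADMM CTADMM.Problem in
theorem theorem1 {N n₀ : ℕ} {n q : Fin N → ℕ} (hN : 2 ≤ N)
    (P : CTADMM.Problem N n₀ n q) (hP : P.ConvexCompact)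
    (hsaddle : ∃ x lam α, P.IsSaddle x lam α)
    (G : SimpleGraph (Fin N)) [DecidableRel G.Adj] (W : Matrix (Fin N) (Fin N) ℝ)
    (hW : CTADMM.IsCommNetwork G W)
    (ρ σ : ℝ) (hρ : 0 < ρ) (hσ : 0 < σ)
    (y : ℕ → Fin N → CTADMM.Decision n) (lam eta : ℕ → Fin N → EuclideanSpace ℝ (Fin n₀))
    (v : ℕ → Fin N → CTADMM.Decision n) (hrun : P.IsRun G W ρ σ y lam eta v) :
    ∃ (ystar : Fin N → CTADMM.Decision n) (θstar : G.edgeSet → CTADMM.Decision n)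
      (lamstar : EuclideanSpace ℝ (Fin n₀)) (μstar : G.Dart → CTADMM.Decision n),
      P.IsEdgeOptimal G ystar θstar ∧
      P.IsEdgeSaddle G ystar θstar lamstar μstar ∧
      Tendsto (fun k => P.H (y (k + 1))) atTop (𝓝 (P.H ystar)) ∧
      Tendsto y atTop (𝓝 ystar) ∧
      ∀ i, Tendsto (fun k => lam k i) atTop (𝓝 lamstar) := by
  have hdeg := hW.degree_ne_zero hN
  obtain ⟨B, hB₁, hB₂⟩ := exists_laplacian_pseudoinverse (E := EuclideanSpace ℝ (Fin n₀)) hW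
  obtain ⟨x₀, ls₀, μ₀, hk₀⟩ := exists_isKKT hP hsaddle hW
  obtain ⟨x, ls, μ, φ, hφ, hk, hy, hlam, hμ⟩ :=
    hrun.exists_subseq_tendsto hP hW hdeg hρ hσ hB₁ hB₂ hk₀
  -- The Lyapunov function is now anchored at the limit point instead of the initial KKT point, so
  -- its monotone limit is decided by the subsequence.
  have hdec := hrun.lyapunov_succ_add_dissipation_le hP hW hdeg hρ hσ hB₁ hB₂ hk
  have hVb := lyapunov_bounds (P := P) (y := y) (lam := lam) (eta := eta) (B := B) (x := x)
    (ls := ls) (μ := μ) hW hρ hσ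
  have hDb := dissipation_bounds (G := G) (y := y) (lam := lam) (ls := ls) hW hρ hσ
  have hD := tendsto_zero_of_add_le_of_nonneg (fun k => (hVb k).1) (fun k => (hDb k).1) hdec
  have hV := tendsto_zero_of_antitone_of_subseq (fun k => (hVb k).1)
    (antitone_nat_of_succ_le fun k => by linarith [hdec k, (hDb k).1])
    ((tendsto_add_atTop_nat 1).comp hφ.tendsto_atTop)
    (hrun.tendsto_lyapunov_subseq hW hρ hσ hB₂ hD hφ hy hlam hμ)
  obtain ⟨-, -, hμd, -⟩ := hrun.tendsto_of_dissipation hW hρ hσ hD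
  have hylim : Tendsto y atTop (𝓝 fun _ => x) := by
    refine tendsto_pi_nhds.2 fun i => (tendsto_add_atTop_iff_nat 1).1 ?_
    obtain ⟨e, rfl⟩ := exists_outDart (hdeg i)
    have h1 : Tendsto (fun k => edgeMean (y k) e - x) atTop (𝓝 0) :=
      tendsto_zero_of_norm_sq_le hV fun k => (hVb k).2.2.2 e
    have h2 := ((h1.comp (tendsto_add_atTop_nat 1)).add_const x).add ((hμd e).const_smul ρ⁻¹)
    rw [smul_zero, add_zero, zero_add] at h2
    refine h2.congr fun k => ?_
    rw [fst_eq_edgeMean_add hρ y]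
    simp
  have hLlim : Tendsto (fun k => dualError lam ls (k + 1)) atTop (𝓝 0) := by
    -- Adding V at k + 1 to the dissipation at k controls ⟨b, Wb⟩ + ⟨b, (1 - W)b⟩ = ‖b‖².
    have hVD := (hV.comp (tendsto_add_atTop_nat 1)).add hD
    rw [add_zero] at hVD
    refine tendsto_zero_of_norm_sq_le (c := σ) hVD fun k => ?_
    have c1 := (hVb (k + 1)).2.1
    have c2 := (hDb k).2.1
    rw [inner_sub_right, real_inner_self_eq_norm_sq] at c2
    simp only [Function.comp_apply]
    linarith
  refine ⟨fun _ => x, fun _ => x, ls, μ, hk.isEdgeOptimal, hk.isEdgeSaddle, ?_, hylim,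
    fun i => (tendsto_add_atTop_iff_nat 1).1 ?_⟩
  · refine tendsto_finsetSum _ fun i _ => ((hP.continuous_f i).tendsto x).comp ?_
    exact (tendsto_pi_nhds.1 hylim i).comp (tendsto_add_atTop_nat 1)
  · have h := (((PiLp.continuous_apply 2 _ i).tendsto 0).comp hLlim).add_const ls
    simp only [PiLp.zero_apply, zero_add] at h
    exact h.congr fun k => by simp [dualError]
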